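/- **Theorem (push of the hybrid k-priority data structure).** Finitely many *places* (asynchronous sequential threads that may be delayed or stop at any time) share a pool of tasks through the operations `push` and `pop`; their steps, each containing at most one access to shared memory, are interleaved arbitrarily (memory allocation and operations on private data, such as a place's sequential priority queue, count as single steps). There is a global linked list of items; each place has its own local linked list of items, a priority queue of references to items, an iterator into the global list, and a counter $r\in\mathbb N\cup\{\infty\}$, initially $\infty$. An item carries its place, a parameter $k\in\mathbb N$, a task and a flag *taken*. `push(k, task)` at place $p$: create an item; append it to the local list of $p$; put a reference to it into the priority queue of $p$; set $r:=\min(r-1,k)$; if $r=0$, repeat [read the global list up to its last node, adding references to the untaken items of other places to the priority queue of $p$; then try to append the local list of $p$ to the global list by one compare-and-swap (CAS) of the `next` pointer of the last node from null to the head of the local list] until the CAS succeeds, and then give $p$ a new empty local list and set $r:=\infty$. `pop` at place $p$: repeat [read the global list as above; while the priority queue of $p$ is non-empty, remove a reference of highest priority from it; if that item is not taken, try to mark it taken by an atomic test-and-set and return its task if this succeeds; otherwise read the global list again; once the priority queue is empty, choose an arbitrary place and add references to the untaken items of other places than $p$ found in that place's local list] as long as the priority queue of $p$ is non-empty after this;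 then return null. Then, in all executions from the empty data structure: 1. *Lock-freedom.* A place inside a `push` can always take a step, and in every infinite execution in which infinitely many steps are taken inside `push` operations, infinitely many `push` operations complete. 2. *Wait-freedom while there is local room.* There is a constant $B$ such that a `push(k, task)` performs at most $B$ steps, whatever the other places do, if at its invocation $k>0$ and every task in the local list of its place will, counting the new task, still be followed in that list by fewer tasks than its own parameter. If all parameters are equal to $k$, this condition says that the local list holds fewer than $k$ tasks. 3. *Linearizability.* Every finite execution can be linearized: each completed operation, and possibly some pending ones, takes effect at a single step of its own between its invocation and its response, and in the order of these steps the operations and their results form a legal sequential history of a task pool, where `push` adds its task to the multiset of available tasks, and `pop` removes and returns an available task or returns null. The linearization point of a `push` is its successful CAS that appends the local list to the global list, if it performs one and its task has not been taken before that CAS; otherwise it is the insertion of its item into the local list. A `pop` that returns a task takes effect when it marks the item as taken. The multiset of available tasks at the end of the execution consists of the tasks of the untaken items stored in the local lists and the global list. 4. *Relaxation.* Whenever a place is not inside a `push`, its local list consists of items of that place, each followed in the list by fewer tasks than its own parameter $k$. -/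

import Mathlib

/-!
The hybrid `k`-priority task pool as an asynchronous shared-memory machine: finitely many places,
each running a sequence of `push` and `pop` calls, interleaved arbitrarily at the granularity of
single shared-memory accesses.  Operations on data private to a place (its priority queue, its
iterator, its counter `remaining_k`) and memory allocation count as one step each.
-/

namespace HybridK

/-- Nodes of linked lists.  `root` is the dummy first node of the global list; every other node
carries exactly one item and is named by the address of that item. -/
inductive Node where
  | root : Node
  | item (a : ℕ) : Node
deriving DecidableEq

/-- The immutable fields of an item. -/
structure ItemData (Place Task : Type*) where
  place : Place
  k : ℕ
  task : Task

/-- `processGlobalList` is called from both operations. -/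
inductive Caller where
  | inPush : Caller
  | inPop : Caller

/-- Control state of a place, with the contents of its local variables. -/
inductive PC (Place Task : Type*) where
  /-- between two operations -/
  | idle
  /-- `it = new Item(place, k, task)` -/
  | pushNew (k : ℕ) (t : Task)
  /-- `place.local_list.add(it)` -/
  | pushAdd (k : ℕ) (a : ℕ)
  /-- `place.prio_queue.push(new ItemRef(it))` -/
  | pushRef (k : ℕ) (a : ℕ)
  /-- `remaining_k = min(remaining_k - 1, k); if (remaining_k == 0)` -/
  | pushCount (k : ℕ)
  /-- read `global_list.tail`, the operand of the CAS -/
  | pushTail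
  /-- `CAS(v.next, null, local_list.head)` -/
  | pushCAS (v : Node)
  /-- `place.local_list = new List()` -/
  | pushNewList
  /-- `remaining_k = ∞` -/
  | pushReset
  /-- return from `push` -/
  | pushRet
  /-- `while (place.iterator ≠ global_list.tail)` -/
  | glTest (c : Caller)
  /-- `it = place.iterator.item()` and the test `it.place ≠ place` -/
  | glItem (c : Caller)
  /-- the test `¬ it.taken`, and the insertion into the priority queue -/
  | glTaken (c : Caller) (a : ℕ)
  /-- `place.iterator = place.iterator.next` -/
  | glNext (c : Caller)
  /-- `while (¬ place.prio_queue.empty()) r = prio_queue.pop()` -/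
  | popTest
  /-- `if (¬ r.item.taken) ret = r.item.task` -/
  | popCheck (a : ℕ)
  /-- `if (TAS(r.item.taken)) return ret` -/
  | popTAS (a : ℕ) (t : Task)
  /-- `vl = getRandVictim().local_list` -/
  | spyPick
  /-- read the head of `vl` -/
  | spyHead (l : Place × ℕ)
  /-- `foreach (it in vl)`: end-of-list test and the test `it.place ≠ place` -/
  | spyAt (o : Option ℕ)
  /-- the test `¬ it.taken`, and the insertion into the priority queue -/
  | spyTaken (a : ℕ)
  /-- advance to the next item of `vl` -/
  | spyNext (a : ℕ)
  /-- `while (¬ place.prio_queue.empty())` of the outer loop of `pop` -/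
  | popLoop
  /-- return from `pop`; `none` is the value `null` -/
  | popRet (r : Option Task)

/-- The control states inside a `push`. -/
def PC.InPush {Place Task : Type*} : PC Place Task → Prop
  | .pushNew _ _ | .pushAdd _ _ | .pushRef _ _ | .pushCount _ | .pushTail | .pushCAS _
  | .pushNewList | .pushReset | .pushRet => True
  | .glTest .inPush | .glItem .inPush | .glTaken .inPush _ | .glNext .inPush => True
  | _ => False

/-- Configurations.  A list object is named by a pair: `(p, n)` is the list created by place `p`
after having created `n` earlier ones. -/
structure Config (Place Task : Type*) where
  /-- first unused item address -/
  fresh : ℕ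
  /-- immutable part of the allocated items -/
  item : ℕ → Option (ItemData Place Task)
  /-- the `taken` flags -/
  taken : ℕ → Bool
  /-- the `next` pointers; `none` is `null` -/
  next : Node → Option ℕ
  /-- the `head` pointers of list objects -/
  head : Place × ℕ → Option ℕ
  /-- `p.local_list` is the list object `(p, cur p)` -/
  cur : Place → ℕ
  /-- last element of the local list (used by the owner only) -/
  last : Place → Option ℕ
  /-- `remaining_k` -/
  remaining : Place → ℕ∞
  /-- the local priority queues, holding item references -/
  pq : Place → Multiset ℕ
  /-- last node of the global list that the place has read -/
  iter : Place → Node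
  pc : Place → PC Place Task

/-- The initial configuration: everything is empty and every place is idle. -/
def init (Place Task : Type*) : Config Place Task where
  fresh := 0
  item := fun _ => none
  taken := fun _ => false
  next := fun _ => none
  head := fun _ => none
  cur := fun _ => 0
  last := fun _ => none
  remaining := fun _ => ⊤
  pq := fun _ => 0
  iter := fun _ => .root
  pc := fun _ => .idle

/-- Labels of steps. -/
inductive Event (Place Task : Type*) where
  /-- invocation of `push` with parameter `k` and task `t` -/
  | invPush (p : Place) (k : ℕ) (t : Task)
  /-- invocation of `pop` -/
  | invPop (p : Place)
  /-- `p` inserts item `a` into its local list -/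
  | insert (p : Place) (a : ℕ)
  /-- successful CAS by which `p` appends its local list to the global list -/
  | publish (p : Place)
  /-- successful TAS by which `p` takes item `a` -/
  | take (p : Place) (a : ℕ)
  /-- any other step inside an operation -/
  | tau (p : Place)
  /-- response of `push` -/
  | retPush (p : Place)
  /-- response of `pop` -/
  | retPop (p : Place) (r : Option Task)

/-- The place that performs the step. -/
def Event.place {Place Task : Type*} : Event Place Task → Place
  | .invPush p _ _ | .invPop p | .insert p _ | .publish p | .take p _ | .tau p | .retPush p
  | .retPop p _ => p

/-- The step is an invocation. -/
def Event.IsInv {Place Task : Type*} : Event Place Task → Prop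
  | .invPush _ _ _ | .invPop _ => True
  | _ => False

/-- The step is a response. -/
def Event.IsRet {Place Task : Type*} : Event Place Task → Prop
  | .retPush _ | .retPop _ _ => True
  | _ => False

section Machine

variable {Place Task Prio : Type*}

/-- `y` follows `x` in a linked list. -/
def Config.Succ (s : Config Place Task) (x y : Node) : Prop :=
  ∃ a, s.next x = some a ∧ y = .item a

/-- `global_list.tail` is `v`: `v` is the node of the global list whose `next` is `null`. -/
def Config.IsTail (s : Config Place Task) (v : Node) : Prop :=
  Relation.ReflTransGen s.Succ .root v ∧ s.next v = none

variable [DecidableEq Place]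

/-- Move the control of place `p` to `c`. -/
def Config.goto (s : Config Place Task) (p : Place) (c : PC Place Task) : Config Place Task :=
  { s with pc := Function.update s.pc p c }

/-- Put a reference to item `a` into the priority queue of `p`. -/
def Config.addRef (s : Config Place Task) (p : Place) (a : ℕ) : Config Place Task :=
  { s with pq := Function.update s.pq p (a ::ₘ s.pq p) }

/-- Allocate a new item. -/
def Config.alloc (s : Config Place Task) (d : ItemData Place Task) : Config Place Task :=
  { s with fresh := s.fresh + 1, item := Function.update s.item s.fresh (some d) }

/-- Link item `a` to the end of the local list of `p`: a single write to shared memory. -/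
def Config.link (s : Config Place Task) (p : Place) (a : ℕ) : Config Place Task :=
  match s.last p with
  | none => { s with
      head := Function.update s.head (p, s.cur p) (some a)
      last := Function.update s.last p (some a) }
  | some b => { s with
      next := Function.update s.next (.item b) (some a)
      last := Function.update s.last p (some a) }

/-- Where control continues after `processGlobalList`. -/
def Caller.after {Place Task : Type*} : Caller → PC Place Task
  | .inPush => .pushTail
  | .inPop => .popTest

variable [LinearOrder Prio]

/-- The atomic steps.  `prio` is the priority function of the application. -/
inductive Step (prio : Task → Prio) :
    Config Place Task → Event Place Task → Config Place Task → Prop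
  -- push
  | invPush (s : Config Place Task) (p : Place) (k : ℕ) (t : Task) : s.pc p = .idle →
      Step prio s (.invPush p k t) (s.goto p (.pushNew k t))
  | pushNew (s : Config Place Task) (p : Place) (k : ℕ) (t : Task) : s.pc p = .pushNew k t →
      Step prio s (.tau p) ((s.alloc ⟨p, k, t⟩).goto p (.pushAdd k s.fresh))
  | pushAdd (s : Config Place Task) (p : Place) (k a : ℕ) : s.pc p = .pushAdd k a →
      Step prio s (.insert p a) ((s.link p a).goto p (.pushRef k a))
  | pushRef (s : Config Place Task) (p : Place) (k a : ℕ) : s.pc p = .pushRef k a →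
      Step prio s (.tau p) ((s.addRef p a).goto p (.pushCount k))
  | pushCount (s : Config Place Task) (p : Place) (k : ℕ) (r : ℕ∞) : s.pc p = .pushCount k →
      r = min (s.remaining p - 1) (k : ℕ∞) →
      Step prio s (.tau p)
        ({ s with remaining := Function.update s.remaining p r }.goto p
          (if r = 0 then .glTest .inPush else .pushRet))
  | pushTail (s : Config Place Task) (p : Place) (v : Node) : s.pc p = .pushTail →
      s.IsTail v → Step prio s (.tau p) (s.goto p (.pushCAS v))
  | pushCAS_success (s : Config Place Task) (p : Place) (v : Node) : s.pc p = .pushCAS v →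
      s.next v = none →
      Step prio s (.publish p)
        ({ s with next := Function.update s.next v (s.head (p, s.cur p)) }.goto p .pushNewList)
  | pushCAS_failure (s : Config Place Task) (p : Place) (v : Node) : s.pc p = .pushCAS v →
      s.next v ≠ none → Step prio s (.tau p) (s.goto p (.glTest .inPush))
  | pushNewList (s : Config Place Task) (p : Place) : s.pc p = .pushNewList →
      Step prio s (.tau p)
        ({ s with
            cur := Function.update s.cur p (s.cur p + 1)
            head := Function.update s.head (p, s.cur p + 1) none
            last := Function.update s.last p none }.goto p .pushReset)
  | pushReset (s : Config Place Task) (p : Place) : s.pc p = .pushReset →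
      Step prio s (.tau p)
        ({ s with remaining := Function.update s.remaining p ⊤ }.goto p .pushRet)
  | pushRet (s : Config Place Task) (p : Place) : s.pc p = .pushRet →
      Step prio s (.retPush p) (s.goto p .idle)
  -- processGlobalList; the item of the iterator is the first one that has not been read
  | glTest_done (s : Config Place Task) (p : Place) (c : Caller) : s.pc p = .glTest c →
      s.IsTail (s.iter p) → Step prio s (.tau p) (s.goto p c.after)
  | glTest_more (s : Config Place Task) (p : Place) (c : Caller) (v : Node) :
      s.pc p = .glTest c → s.IsTail v → s.iter p ≠ v →
      Step prio s (.tau p) (s.goto p (.glItem c))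
  | glItem_own (s : Config Place Task) (p : Place) (c : Caller) (a : ℕ)
      (d : ItemData Place Task) : s.pc p = .glItem c → s.next (s.iter p) = some a →
      s.item a = some d → d.place = p → Step prio s (.tau p) (s.goto p (.glNext c))
  | glItem_other (s : Config Place Task) (p : Place) (c : Caller) (a : ℕ)
      (d : ItemData Place Task) : s.pc p = .glItem c → s.next (s.iter p) = some a →
      s.item a = some d → d.place ≠ p → Step prio s (.tau p) (s.goto p (.glTaken c a))
  | glTaken_skip (s : Config Place Task) (p : Place) (c : Caller) (a : ℕ) :
      s.pc p = .glTaken c a → s.taken a = true → Step prio s (.tau p) (s.goto p (.glNext c))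
  | glTaken_add (s : Config Place Task) (p : Place) (c : Caller) (a : ℕ) :
      s.pc p = .glTaken c a → s.taken a = false →
      Step prio s (.tau p) ((s.addRef p a).goto p (.glNext c))
  | glNext (s : Config Place Task) (p : Place) (c : Caller) (a : ℕ) :
      s.pc p = .glNext c → s.next (s.iter p) = some a →
      Step prio s (.tau p)
        ({ s with iter := Function.update s.iter p (.item a) }.goto p (.glTest c))
  -- pop
  | invPop (s : Config Place Task) (p : Place) : s.pc p = .idle →
      Step prio s (.invPop p) (s.goto p (.glTest .inPop))
  | popTest_empty (s : Config Place Task) (p : Place) : s.pc p = .popTest → s.pq p = 0 →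
      Step prio s (.tau p) (s.goto p .spyPick)
  | popTest_pop (s : Config Place Task) (p : Place) (a : ℕ) : s.pc p = .popTest → a ∈ s.pq p →
      (∀ b ∈ s.pq p, ∀ d d' : ItemData Place Task, s.item a = some d → s.item b = some d' →
        prio d'.task ≤ prio d.task) →
      Step prio s (.tau p)
        ({ s with pq := Function.update s.pq p ((s.pq p).erase a) }.goto p (.popCheck a))
  | popCheck_taken (s : Config Place Task) (p : Place) (a : ℕ) : s.pc p = .popCheck a →
      s.taken a = true → Step prio s (.tau p) (s.goto p (.glTest .inPop))
  | popCheck_free (s : Config Place Task) (p : Place) (a : ℕ) (d : ItemData Place Task) :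
      s.pc p = .popCheck a → s.taken a = false → s.item a = some d →
      Step prio s (.tau p) (s.goto p (.popTAS a d.task))
  | popTAS_success (s : Config Place Task) (p : Place) (a : ℕ) (t : Task) :
      s.pc p = .popTAS a t → s.taken a = false →
      Step prio s (.take p a)
        ({ s with taken := Function.update s.taken a true }.goto p (.popRet (some t)))
  | popTAS_failure (s : Config Place Task) (p : Place) (a : ℕ) (t : Task) :
      s.pc p = .popTAS a t → s.taken a = true →
      Step prio s (.tau p) (s.goto p (.glTest .inPop))
  | spyPick (s : Config Place Task) (p victim : Place) : s.pc p = .spyPick →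
      Step prio s (.tau p) (s.goto p (.spyHead (victim, s.cur victim)))
  | spyHead (s : Config Place Task) (p : Place) (l : Place × ℕ) : s.pc p = .spyHead l →
      Step prio s (.tau p) (s.goto p (.spyAt (s.head l)))
  | spyAt_end (s : Config Place Task) (p : Place) : s.pc p = .spyAt none →
      Step prio s (.tau p) (s.goto p .popLoop)
  | spyAt_own (s : Config Place Task) (p : Place) (a : ℕ) (d : ItemData Place Task) :
      s.pc p = .spyAt (some a) → s.item a = some d → d.place = p →
      Step prio s (.tau p) (s.goto p (.spyNext a))
  | spyAt_other (s : Config Place Task) (p : Place) (a : ℕ) (d : ItemData Place Task) :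
      s.pc p = .spyAt (some a) → s.item a = some d → d.place ≠ p →
      Step prio s (.tau p) (s.goto p (.spyTaken a))
  | spyTaken_skip (s : Config Place Task) (p : Place) (a : ℕ) : s.pc p = .spyTaken a →
      s.taken a = true → Step prio s (.tau p) (s.goto p (.spyNext a))
  | spyTaken_add (s : Config Place Task) (p : Place) (a : ℕ) : s.pc p = .spyTaken a →
      s.taken a = false → Step prio s (.tau p) ((s.addRef p a).goto p (.spyNext a))
  | spyNext (s : Config Place Task) (p : Place) (a : ℕ) : s.pc p = .spyNext a →
      Step prio s (.tau p) (s.goto p (.spyAt (s.next (.item a))))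
  | popLoop_again (s : Config Place Task) (p : Place) : s.pc p = .popLoop → s.pq p ≠ 0 →
      Step prio s (.tau p) (s.goto p (.glTest .inPop))
  | popLoop_fail (s : Config Place Task) (p : Place) : s.pc p = .popLoop → s.pq p = 0 →
      Step prio s (.tau p) (s.goto p (.popRet none))
  | popRet (s : Config Place Task) (p : Place) (r : Option Task) : s.pc p = .popRet r →
      Step prio s (.retPop p r) (s.goto p .idle)

/-- `s 0, e 0, s 1, …, e (n - 1), s n` is an execution with `n` steps. -/
def IsExec (prio : Task → Prio) (s : ℕ → Config Place Task) (e : ℕ → Event Place Task) (n : ℕ) :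
    Prop :=
  s 0 = init Place Task ∧ ∀ i < n, Step prio (s i) (e i) (s (i + 1))

/-! ### Progress -/

/-- `push` is lock-free.  A place inside a `push` is never blocked; and if, in an infinite
execution, infinitely many steps are performed inside `push` operations, then infinitely many
`push` operations are completed.  Nothing is assumed about the scheduler: places may be delayed
arbitrarily or stop altogether. -/
def PushLockFree (Place : Type*) [DecidableEq Place] (prio : Task → Prio) : Prop :=
  (∀ (s : ℕ → Config Place Task) (e : ℕ → Event Place Task) (n : ℕ), IsExec prio s e n →
    ∀ p, ((s n).pc p).InPush → ∃ (ev : Event Place Task) (s' : Config Place Task),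
      ev.place = p ∧ Step prio (s n) ev s') ∧
  ∀ (s : ℕ → Config Place Task) (e : ℕ → Event Place Task), (∀ n, IsExec prio s e n) →
    {n | ((s n).pc (e n).place).InPush}.Infinite →
    {n | ∃ p, e n = .retPush p}.Infinite

/-- The items of the linked list that starts at `o` are, in order, `L`. -/
def Config.ListFrom (s : Config Place Task) : Option ℕ → List ℕ → Prop
  | o, [] => o = none
  | o, a :: L => o = some a ∧ s.ListFrom (s.next (.item a)) L

/-- The items of the local list of `p` are `L`, oldest first. -/
def Config.IsLocalList (s : Config Place Task) (p : Place) (L : List ℕ) : Prop :=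
  s.ListFrom (s.head (p, s.cur p)) L

/-- A task with parameter `k` can be added to the local list `L` while each task, counting the new
one, is still followed by fewer tasks than its own parameter `k` allows.  When all parameters are
equal to `k` this says that `L` holds fewer than `k` tasks. -/
def Config.HasRoom (s : Config Place Task) (L : List ℕ) (k : ℕ) : Prop :=
  0 < k ∧ ∀ (L₁ : List ℕ) (a : ℕ) (L₂ : List ℕ), L = L₁ ++ a :: L₂ →
    ∀ d, s.item a = some d → L₂.length + 1 < d.k

/-- Step `m` belongs to the operation invoked at step `i` (after the invocation, up to and
including the response). -/
def During (e : ℕ → Event Place Task) (i m : ℕ) : Prop :=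
  (e i).IsInv ∧ i < m ∧ (e m).place = (e i).place ∧
    ∀ j, i < j → j < m → (e j).place = (e i).place → ¬ (e j).IsRet

/-- A `push` that finds room in the local list is wait-free: whatever the other places do, it
performs at most `B` steps, for a constant `B`. -/
def PushWaitFreeWithRoom (Place : Type*) [DecidableEq Place] (prio : Task → Prio) : Prop :=
  ∃ B : ℕ, ∀ (s : ℕ → Config Place Task) (e : ℕ → Event Place Task) (n : ℕ), IsExec prio s e n →
    ∀ (i : ℕ) (p : Place) (k : ℕ) (t : Task) (L : List ℕ), i < n → e i = .invPush p k t →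
      (s i).IsLocalList p L → (s i).HasRoom L k →
      {m | m < n ∧ During e i m}.ncard ≤ B

/-- Between two `push` operations of `p`, the local list of `p` consists of items of `p`, each of
which is followed by fewer tasks than its parameter `k`; in particular no task stays unpublished
once `k` later tasks have been pushed at its place. -/
def LocalListsRelaxed (Place : Type*) [DecidableEq Place] (prio : Task → Prio) : Prop :=
  ∀ (s : ℕ → Config Place Task) (e : ℕ → Event Place Task) (n : ℕ), IsExec prio s e n →
    ∀ p, ¬ ((s n).pc p).InPush → ∃ L, (s n).IsLocalList p L ∧
      ∀ (L₁ : List ℕ) (a : ℕ) (L₂ : List ℕ), L = L₁ ++ a :: L₂ →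
        ∃ d, (s n).item a = some d ∧ d.place = p ∧ L₂.length < d.k

/-! ### Linearizability -/

/-- Sequential specification of the task pool: the effect of the operation with invocation `inv`
and result `r` on the multiset of available tasks.  A `pop` removes and returns an available task,
or fails. -/
def SeqSpec (inv : Event Place Task) (r : Option Task) (A A' : Multiset Task) : Prop :=
  match inv, r with
  | .invPush _ _ t, _ => A' = t ::ₘ A
  | .invPop _, some t => A = t ::ₘ A'
  | .invPop _, none => A' = A
  | _, _ => False

/-- Item `a` is stored in some local list or in the global list. -/
def Config.Stored (s : Config Place Task) (a : ℕ) : Prop :=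
  Relation.TransGen s.Succ .root (.item a) ∨
    ∃ p b, s.head (p, s.cur p) = some b ∧ Relation.ReflTransGen s.Succ (.item b) (.item a)

open Classical in
/-- The tasks that are stored in the data structure and have not been taken. -/
noncomputable def Config.contents (s : Config Place Task) : Multiset Task :=
  ((Multiset.range s.fresh).filter fun a => s.Stored a ∧ s.taken a = false).filterMap
    fun a => (s.item a).map ItemData.task

/-- The operations of the first `n` steps are linearized by `pt`, `res`, `A`: the operation invoked
at step `i` takes effect at the step `pt i`, between its invocation and its response, with result
`res i`; `A m` is the abstract state before step `m`.  Every completed operation takes effect, with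
the result that it returned; a pending one may or may not have taken effect. -/
structure IsLinearization (e : ℕ → Event Place Task) (n : ℕ) (pt : ℕ → Option ℕ)
    (res : ℕ → Option Task) (A : ℕ → Multiset Task) : Prop where
  mem : ∀ i m, pt i = some m → m < n ∧ During e i m
  inj : ∀ i j m, pt i = some m → pt j = some m → i = j
  complete : ∀ i j, j < n → During e i j → (e j).IsRet → ∃ m, pt i = some m
  result : ∀ i j p r, j < n → During e i j → e j = .retPop p r → res i = r
  start : A 0 = 0
  effect : ∀ i m, pt i = some m → SeqSpec (e i) (res i) (A m) (A (m + 1))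
  frame : ∀ m < n, (∀ i, pt i ≠ some m) → A (m + 1) = A m

/-- Item `a` is taken before step `m`. -/
def TakenBefore (e : ℕ → Event Place Task) (a m : ℕ) : Prop :=
  ∃ j < m, ∃ q, e j = .take q a

/-- `m` is the linearization point of the `push` invoked at step `i`.  If the `push` itself appends
the local list to the global list and its task has not been taken before, it is the successful CAS;
otherwise it is the insertion into the local list. -/
def IsPushPoint (e : ℕ → Event Place Task) (n i m : ℕ) : Prop :=
  ∃ (p : Place) (a l : ℕ), l < n ∧ During e i l ∧ e l = .insert p a ∧
    ((m < n ∧ During e i m ∧ e m = .publish p ∧ ¬ TakenBefore e a m) ∨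
      (m = l ∧ ∀ c, c < n → During e i c → e c = .publish p → TakenBefore e a c))

/-- `push` is linearizable.  Every finite execution has a linearization in which the `push`
operations take effect precisely at their linearization points (and successful `pop` operations
when they mark their item as taken), and whose final abstract state is the actual contents of the
data structure. -/
def PushLinearizable (Place : Type*) [DecidableEq Place] (prio : Task → Prio) : Prop :=
  ∀ (s : ℕ → Config Place Task) (e : ℕ → Event Place Task) (n : ℕ), IsExec prio s e n →
    ∃ (pt : ℕ → Option ℕ) (res : ℕ → Option Task) (A : ℕ → Multiset Task),
      IsLinearization e n pt res A ∧
      (∀ i < n, ∀ p k t, e i = .invPush p k t → ∀ m, pt i = some m ↔ IsPushPoint e n i m) ∧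
      (∀ i m t p, e i = .invPop p → pt i = some m → res i = some t → ∃ a, e m = .take p a) ∧
      A n = (s n).contents

end Machine

end HybridK

/-!
Everything rests on an invariant `Inv s G L` with two ghost components: the list `G` of published
items, which is the global list, and for each place `p` the list `L p` of the items that `p` has
linked but not yet published.  The shared memory consists of these pairwise disjoint lists, every
item in a priority queue lies in one of them (`Held`), and the counter of `p` is a function
of `L p`, its `budget`, which is the least difference between the parameter of a task of `L p` and
the number of tasks that follow it (`lt_budget_iff`).  `Inv.step` shows that every step preserves
the invariant and that the linked items change only by insertions.

*Relaxation* and *wait-freedom* are then statements about the budget: outside `push` it is positive,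
and if it exceeds `1` and `k` is positive, a `push` does not enter the loop (`IsExec.room_trace`),
so that each of its steps decreases its `PC.stage`.

*Lock-freedom.*  As long as no `push` responds, the sum over all places of the stages does not
increase, so it is eventually constant.  From then on nothing is published and the `next` pointers
do not change any more.  Hence a CAS whose operand is read from now on succeeds, and every step
inside a `push` decreases `loopRank`, which counts the remaining work of the loop; so there are only
finitely many such steps.

*Linearizability.*  Let the abstract state before a step consist of the items whose `push` has
passed its linearization point and that have not been taken (`Live`).  A linearization point is
passed at most once per item, and before the item can be taken: it is the CAS only if the item is
not taken before (`IsExec.exists_itemPoint`).  So each point of a `push` adds the task of its item,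
each successful test-and-set removes the task that the `pop` returns, and nothing else changes the
state.  At the end every linked item has passed its point, so the state consists of the stored items
that are not taken.
-/

namespace HybridK

/-! ### Linked lists -/

/-- `Config.ListFrom` as a property of the `next` pointers alone: following them from `o` one meets
exactly the items of the list, and then `null`. -/
def Linked (next : Node → Option ℕ) : Option ℕ → List ℕ → Prop
  | o, [] => o = none
  | o, a :: L => o = some a ∧ Linked next (next (.item a)) L

theorem Config.listFrom_iff {Place Task : Type*} (s : Config Place Task) (o : Option ℕ)
    (L : List ℕ) : s.ListFrom o L ↔ Linked s.next o L := by
  induction L generalizing o with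
  | nil => rfl
  | cons a L ih => simp only [Config.ListFrom, Linked, ih]

namespace Linked

variable {next next' : Node → Option ℕ} {o : Option ℕ} {L M : List ℕ} {a b : ℕ}

theorem congr (h : Linked next o L) (hn : ∀ a ∈ L, next' (.item a) = next (.item a)) :
    Linked next' o L := by
  induction L generalizing o with
  | nil => exact h
  | cons a L ih =>
    refine ⟨h.1, ?_⟩
    rw [hn a (by simp)]
    exact ih h.2 fun b hb => hn b (by simp [hb])

theorem unique (h : Linked next o L) (h' : Linked next o M) : L = M := by
  induction L generalizing o M with
  | nil =>
    cases M with
    | nil => rfl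
    | cons b M => exact absurd (h.symm.trans h'.1) (by simp)
  | cons a L ih =>
    cases M with
    | nil => exact absurd (h'.symm.trans h.1) (by simp)
    | cons b M =>
      obtain rfl : a = b := Option.some.inj (h.1.symm.trans h'.1)
      rw [ih h.2 h'.2]

theorem getLast?_of_next_eq_none (h : Linked next o L) (hb : b ∈ L)
    (hn : next (.item b) = none) : L.getLast? = some b := by
  induction L generalizing o with
  | nil => simp at hb
  | cons c L ih =>
    rcases List.mem_cons.1 hb with rfl | hb
    · cases L with
      | nil => rfl
      | cons d L => exact absurd (hn.symm.trans h.2.1) (by simp)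
    · have := ih h.2 hb
      rw [List.getLast?_cons, this]; rfl

theorem next_mem (h : Linked next o L) (hb : b ∈ L) (hn : next (.item b) = some a) : a ∈ L := by
  induction L generalizing o with
  | nil => simp at hb
  | cons c L ih =>
    rcases List.mem_cons.1 hb with rfl | hb
    · cases L with
      | nil => exact absurd (hn.symm.trans h.2) (by simp)
      | cons d L =>
        obtain rfl : a = d := Option.some.inj (hn.symm.trans h.2.1)
        simp
    · exact List.mem_cons_of_mem _ (ih h.2 hb)

/-- Redirecting the last `next` pointer of a list to another list concatenates the two. -/
theorem append (h : Linked next o L) (hb : L.getLast? = some b) (hL : L.Nodup)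
    (hn : ∀ a ∈ L, a ≠ b → next' (.item a) = next (.item a))
    (hM : Linked next' (next' (.item b)) M) : Linked next' o (L ++ M) := by
  induction L generalizing o with
  | nil => simp at hb
  | cons c L ih =>
    refine ⟨h.1, ?_⟩
    cases L with
    | nil =>
      obtain rfl : c = b := by simpa using hb
      exact hM
    | cons d L =>
      have hb' : (d :: L).getLast? = some b := by simpa [List.getLast?_cons_cons] using hb
      have hc : c ≠ b := by
        rintro rfl
        exact (List.nodup_cons.1 hL).1 (List.mem_of_getLast? hb')
      rw [hn c (by simp) hc]
      exact ih h.2 hb' (List.nodup_cons.1 hL).2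
        fun a ha => hn a (List.mem_cons_of_mem _ ha)

/-- From each item of a list the remaining part of the list can be reached. -/
theorem suffix (h : Linked next o L) (hb : b ∈ L) : ∃ M, Linked next (next (.item b)) M := by
  induction L generalizing o with
  | nil => simp at hb
  | cons c L ih =>
    rcases List.mem_cons.1 hb with rfl | hb
    · exact ⟨L, h.2⟩
    · exact ih h.2 hb

end Linked

section Reach

variable {Place Task : Type*} {s : Config Place Task} {L : List ℕ} {a b : ℕ} {x y v w : Node}

theorem Linked.reach (h : Linked s.next (some b) L) (ha : a ∈ L) :
    Relation.ReflTransGen s.Succ (.item b) (.item a) := by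
  induction L generalizing b with
  | nil => simp at ha
  | cons c L ih =>
    obtain rfl : b = c := Option.some.inj h.1
    rcases List.mem_cons.1 ha with rfl | ha
    · exact .refl
    · cases L with
      | nil => simp at ha
      | cons d L =>
        have hd := h.2.1
        exact .head ⟨d, hd, rfl⟩ (ih (hd ▸ h.2) ha)

theorem Linked.exists_end (h : Linked s.next (s.next x) L) :
    ∃ v, Relation.ReflTransGen s.Succ x v ∧ s.next v = none := by
  induction L generalizing x with
  | nil => exact ⟨x, .refl, h⟩
  | cons a L ih =>
    obtain ⟨v, hv, hn⟩ := ih h.2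
    exact ⟨v, .head ⟨a, h.1, rfl⟩ hv, hn⟩

theorem Config.Succ.eq (h : s.Succ x y) (h' : s.Succ x w) : y = w := by
  obtain ⟨a, ha, rfl⟩ := h
  obtain ⟨b, hb, rfl⟩ := h'
  rw [Option.some.inj (ha.symm.trans hb)]

theorem Config.IsTail.unique (hv : s.IsTail v) (hw : s.IsTail w) : v = w := by
  have key : ∀ {v w : Node}, Relation.ReflTransGen s.Succ v w → s.next v = none → v = w := by
    intro v w h hn
    rcases h.cases_head with rfl | ⟨c, ⟨a, ha, -⟩, -⟩
    · rfl
    · exact absurd (hn.symm.trans ha) (by simp)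
  rcases Relation.ReflTransGen.total_of_right_unique (fun _ _ _ h h' => h.eq h') hv.1 hw.1
    with h | h
  · exact key h hv.2
  · exact (key h hw.2).symm

end Reach

/-! ### The counter -/

/-- The value of the counter `remaining_k` after pushing tasks with the given parameters into an
empty local list. -/
noncomputable def budget (ks : List ℕ) : ℕ∞ := ks.foldl (fun r k => min (r - 1) (k : ℕ∞)) ⊤

theorem budget_append (ks : List ℕ) (k : ℕ) :
    budget (ks ++ [k]) = min (budget ks - 1) (k : ℕ∞) := by
  simp [budget]

/-- The counter encodes the least slack of a task in the list. -/
theorem lt_budget_iff {ks : List ℕ} {m : ℕ} :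
    (m : ℕ∞) < budget ks ↔ ∀ l₁ k l₂, ks = l₁ ++ k :: l₂ → l₂.length + m < k := by
  induction ks using List.reverseRecOn generalizing m with
  | nil => simp [budget]
  | append_singleton ks k ih =>
    have h1 : (m : ℕ∞) < budget ks - 1 ↔ ((m + 1 : ℕ) : ℕ∞) < budget ks := by
      push_cast
      exact lt_tsub_iff_right
    rw [budget_append, lt_min_iff, h1, ih, Nat.cast_lt]
    constructor
    · rintro ⟨h, hk⟩ l₁ k' l₂ he
      rcases List.eq_nil_or_concat l₂ with rfl | ⟨l, x, rfl⟩
      · have := List.append_inj' he rfl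
        simp_all
      · have he' : ks ++ [k] = (l₁ ++ k' :: l) ++ [x] := by simpa using he
        have := (List.append_inj' he' rfl).1
        have := h _ _ _ this
        simp; omega
    · intro h
      refine ⟨fun l₁ k' l₂ he => ?_, by simpa using h ks k [] rfl⟩
      have := h l₁ k' (l₂ ++ [k]) (by simp [he])
      simp at this; omega

/-! ### The invariant -/

/-- Item `a` has been linked: it is in the global list `G` or in one of the lists `L p`. -/
def Held {Place : Type*} (G : List ℕ) (L : Place → List ℕ) (a : ℕ) : Prop :=
  a ∈ G ∨ ∃ p, a ∈ L p

/-- `v` is a node of the global list with items `G`. -/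
def GNode (G : List ℕ) (v : Node) : Prop := v = .root ∨ ∃ a ∈ G, v = .item a

theorem GNode.mono {G G' : List ℕ} {v : Node} (h : GNode G v) (hG : G ⊆ G') : GNode G' v :=
  h.imp_right fun ⟨a, ha, hv⟩ => ⟨a, hG ha, hv⟩

section Invariant

variable {Place Task Prio : Type*}

/-- The parameter of item `a`, and `0` if `a` is not allocated. -/
def Config.kOf (s : Config Place Task) (a : ℕ) : ℕ := ((s.item a).map ItemData.k).getD 0

/-- The counter of `p` agrees with the list `L p`, all of whose tasks are followed by fewer tasks
than their parameters. -/
def Config.BudgetOk (s : Config Place Task) (L : Place → List ℕ) (p : Place) : Prop :=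
  s.remaining p = budget ((L p).map s.kOf) ∧ 0 < budget ((L p).map s.kOf)

/-- What holds at `p` while it reads the global list. -/
def Config.CallerOk (s : Config Place Task) (L : Place → List ℕ) (p : Place) : Caller → Prop
  | .inPush => L p ≠ []
  | .inPop => s.BudgetOk L p

/-- The part of the invariant that depends on the control state of `p`.  Between the insertion of an
item and the update of the counter, the budget of the list is the value that the counter is about to
receive; in the loop of a `push` all that matters is that there is something to publish. -/
def Config.CtlOk (s : Config Place Task) (G : List ℕ) (L : Place → List ℕ) (p : Place) :
    PC Place Task → Prop
  | .idle => s.BudgetOk L p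
  | .pushNew _ _ => s.BudgetOk L p
  | .pushAdd k a => s.BudgetOk L p ∧ ¬ Held G L a ∧ ∃ t, s.item a = some ⟨p, k, t⟩
  | .pushRef k a => Held G L a ∧ L p ≠ [] ∧
      min (s.remaining p - 1) (k : ℕ∞) = budget ((L p).map s.kOf)
  | .pushCount k => L p ≠ [] ∧ min (s.remaining p - 1) (k : ℕ∞) = budget ((L p).map s.kOf)
  | .pushTail => L p ≠ []
  | .pushCAS v => L p ≠ [] ∧ GNode G v
  | .pushNewList => L p = []
  | .pushReset => L p = []
  | .pushRet => s.BudgetOk L p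
  | .glTest c => s.CallerOk L p c
  | .glItem c => s.CallerOk L p c ∧ s.next (s.iter p) ≠ none
  | .glTaken c a => s.CallerOk L p c ∧ s.next (s.iter p) ≠ none ∧ Held G L a
  | .glNext c => s.CallerOk L p c ∧ s.next (s.iter p) ≠ none
  | .popTest => s.BudgetOk L p
  | .popCheck a => s.BudgetOk L p ∧ Held G L a
  | .popTAS a t => s.BudgetOk L p ∧ Held G L a ∧ ∃ d, s.item a = some d ∧ d.task = t
  | .spyPick => s.BudgetOk L p
  | .spyHead _ => s.BudgetOk L p
  | .spyAt o => s.BudgetOk L p ∧ ∀ a, o = some a → Held G L a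
  | .spyTaken a => s.BudgetOk L p ∧ Held G L a
  | .spyNext a => s.BudgetOk L p ∧ Held G L a
  | .popLoop => s.BudgetOk L p
  | .popRet _ => s.BudgetOk L p

/-- The shared memory is well-formed: `G` is the global list, and the lists `L p` of items that are
linked but not yet published are disjoint from it and from each other. -/
structure MemOk (s : Config Place Task) (G : List ℕ) (L : Place → List ℕ) : Prop where
  global : Linked s.next (s.next .root) G
  nodupG : G.Nodup
  nodupL : ∀ p, (L p).Nodup
  disj : ∀ p, ∀ a ∈ L p, a ∉ G
  own : ∀ p, ∀ a ∈ L p, ∃ d, s.item a = some d ∧ d.place = p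
  alloc : ∀ a ∈ G, ∃ d, s.item a = some d
  off : ∀ a, ¬ Held G L a → s.next (.item a) = none
  fresh : ∀ a, s.fresh ≤ a → s.item a = none
  head : ∀ l b, s.head l = some b → Held G L b

/-- The part of the invariant that concerns place `p`.  Between the publication of its local list
and the creation of a new one the list `L p` is empty, although the list object is not. -/
structure PlaceOk (s : Config Place Task) (G : List ℕ) (L : Place → List ℕ) (p : Place) :
    Prop where
  list : s.pc p ≠ .pushNewList →
    Linked s.next (s.head (p, s.cur p)) (L p) ∧ s.last p = (L p).getLast?
  iter : GNode G (s.iter p)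
  pq : ∀ a ∈ s.pq p, Held G L a
  ctl : s.CtlOk G L p (s.pc p)

/-- The invariant of the machine, for the global list `G` and the unpublished local lists `L`. -/
structure Inv (s : Config Place Task) (G : List ℕ) (L : Place → List ℕ) : Prop where
  mem : MemOk s G L
  place : ∀ p, PlaceOk s G L p

variable {s s' : Config Place Task} {G G' : List ℕ} {L L' : Place → List ℕ}

theorem MemOk.held_alloc (h : MemOk s G L) {a : ℕ} (ha : Held G L a) :
    ∃ d, s.item a = some d := by
  rcases ha with ha | ⟨p, ha⟩
  · exact h.alloc a ha
  · exact (h.own p a ha).imp fun _ h => h.1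

theorem MemOk.held_lt (h : MemOk s G L) {a : ℕ} (ha : Held G L a) : a < s.fresh := by
  by_contra hlt
  obtain ⟨d, hd⟩ := h.held_alloc ha
  exact absurd ((h.fresh a (not_lt.1 hlt)).symm.trans hd) (by simp)

theorem MemOk.gnode_next (h : MemOk s G L) {v : Node} (hv : GNode G v) {a : ℕ}
    (ha : s.next v = some a) : a ∈ G := by
  rcases hv with rfl | ⟨b, hb, rfl⟩
  · cases G with
    | nil => exact absurd (ha.symm.trans h.global) (by simp)
    | cons c G =>
      obtain rfl : a = c := Option.some.inj (ha.symm.trans h.global.1)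
      simp
  · exact h.global.next_mem hb ha

theorem MemOk.gnode_reach (h : MemOk s G L) {v : Node} (hv : GNode G v) :
    Relation.ReflTransGen s.Succ .root v := by
  rcases hv with rfl | ⟨a, ha, rfl⟩
  · exact .refl
  · cases G with
    | nil => simp at ha
    | cons c G =>
      have hg := h.global
      exact .head ⟨c, hg.1, rfl⟩ (Linked.reach (hg.1 ▸ hg) ha)

theorem MemOk.reach_gnode (h : MemOk s G L) {v w : Node} (hv : GNode G v)
    (hw : Relation.ReflTransGen s.Succ v w) : GNode G w := by
  induction hw with
  | refl => exact hv
  | tail _ h' ih =>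
    obtain ⟨a, ha, rfl⟩ := h'
    exact .inr ⟨a, h.gnode_next ih ha, rfl⟩

theorem MemOk.exists_tail (h : MemOk s G L) : ∃ v, s.IsTail v := h.global.exists_end

theorem MemOk.next_ne_none (h : MemOk s G L) {v w : Node} (hv : GNode G v) (hw : s.IsTail w)
    (hne : v ≠ w) : s.next v ≠ none :=
  fun hn => hne (Config.IsTail.unique ⟨h.gnode_reach hv, hn⟩ hw)

theorem Inv.held_next (h : Inv s G L) {a b : ℕ} (ha : Held G L a)
    (hb : s.next (.item a) = some b) : Held G L b := by
  rcases ha with ha | ⟨p, ha⟩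
  · exact .inl (h.mem.global.next_mem ha hb)
  · by_cases hp : s.pc p = .pushNewList
    · have := (h.place p).ctl
      rw [hp] at this
      change L p = [] at this
      simp [this] at ha
    · exact .inr ⟨p, ((h.place p).list hp).1.next_mem ha hb⟩

theorem Inv.ctl (h : Inv s G L) {p : Place} {c : PC Place Task} (hpc : s.pc p = c) :
    s.CtlOk G L p c :=
  hpc ▸ (h.place p).ctl

/-- The linked items are exactly the stored ones. -/
theorem Inv.stored_iff (h : Inv s G L) (a : ℕ) : s.Stored a ↔ Held G L a := by
  have closed : ∀ {b a : ℕ}, Held G L b → Relation.ReflTransGen s.Succ (.item b) (.item a) →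
      Held G L a := by
    intro b a hb hr
    have : ∀ x, Relation.ReflTransGen s.Succ (.item b) x → ∃ c, x = .item c ∧ Held G L c := by
      intro x hx
      induction hx with
      | refl => exact ⟨b, rfl, hb⟩
      | tail _ hs ih =>
        obtain ⟨c, rfl, hc⟩ := ih
        obtain ⟨d, hd, rfl⟩ := hs
        exact ⟨d, rfl, h.held_next hc hd⟩
    obtain ⟨c, hc, hh⟩ := this _ hr
    cases hc
    exact hh
  constructor
  · rintro (hr | ⟨p, b, hb, hr⟩)
    · rcases Relation.TransGen.head'_iff.1 hr with ⟨x, ⟨b, hb, rfl⟩, hx⟩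
      exact closed (.inl (h.mem.gnode_next (.inl rfl) hb)) hx
    · exact closed (h.mem.head _ _ hb) hr
  · rintro (ha | ⟨p, ha⟩)
    · have hr := h.mem.gnode_reach (.inr ⟨a, ha, rfl⟩)
      rcases hr.cases_head with h' | ⟨c, hc, hr⟩
      · simp at h'
      · exact .inl (.head' hc hr)
    · by_cases hp : s.pc p = .pushNewList
      · have := (h.place p).ctl
        rw [hp] at this
        change L p = [] at this
        simp [this] at ha
      · have hl := ((h.place p).list hp).1
        refine .inr ⟨p, ?_⟩
        generalize L p = M at hl ha
        cases M with
        | nil => simp at ha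
        | cons b M => exact ⟨b, hl.1, Linked.reach (hl.1 ▸ hl) ha⟩

theorem Config.map_kOf_congr {M : List ℕ} (h : ∀ a ∈ M, s'.item a = s.item a) :
    M.map s'.kOf = M.map s.kOf :=
  List.map_congr_left fun a ha => by simp [Config.kOf, h a ha]

/-- A step of another place preserves the invariant of place `q` if it does not touch the private
data of `q` and its unpublished local list, and if lists only grow. -/
theorem PlaceOk.mono {q : Place} (h : PlaceOk s G L q) (hpc : s'.pc q = s.pc q)
    (hrem : s'.remaining q = s.remaining q) (hiter : s'.iter q = s.iter q)
    (hpq : s'.pq q = s.pq q) (hlist : s.pc q ≠ .pushNewList →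
      Linked s'.next (s'.head (q, s'.cur q)) (L q) ∧ s'.last q = s.last q)
    (hL : L' q = L q) (hG : G ⊆ G') (hH : ∀ a, Held G L a → Held G' L' a)
    (hitem : ∀ a d, s.item a = some d → s'.item a = some d)
    (hitemL : ∀ a ∈ L q, s'.item a = s.item a)
    (hnext : ∀ x, s.next x ≠ none → s'.next x ≠ none)
    (hadd : ∀ k a, s.pc q = .pushAdd k a → ¬ Held G' L' a) : PlaceOk s' G' L' q where
  list hp := by
    rw [hpc] at hp
    rw [hL]
    exact ⟨(hlist hp).1, (hlist hp).2.trans (h.list hp).2⟩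
  iter := by
    rw [hiter]
    exact h.iter.mono hG
  pq := by
    rw [hpq]
    exact fun a ha => hH a (h.pq a ha)
  ctl := by
    have hc := h.ctl
    have hk := Config.map_kOf_congr hitemL
    have hB : s.BudgetOk L q → s'.BudgetOk L' q := by
      rintro ⟨h1, h2⟩
      refine ⟨?_, ?_⟩
      · rw [hL, hk, hrem, h1]
      · rwa [hL, hk]
    have hC : ∀ c, s.CallerOk L q c → s'.CallerOk L' q c := by
      rintro (_ | _) h
      · change L' q ≠ []
        rw [hL]
        exact h
      · exact hB h
    rw [hpc]
    generalize hpc' : s.pc q = c at hc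
    cases c with
    | pushAdd k a =>
      obtain ⟨h1, h2, t, ht⟩ := hc
      exact ⟨hB h1, hadd k a hpc', t, hitem _ _ ht⟩
    | popTAS a t =>
      obtain ⟨h1, h2, d, hd, ht⟩ := hc
      exact ⟨hB h1, hH _ h2, d, hitem _ _ hd, ht⟩
    | _ =>
      simp only [Config.CtlOk, hL, hk, hrem, hiter] at hc ⊢
      first
        | exact hB hc
        | exact hC _ hc
        | exact hc
        | exact ⟨hC _ hc.1, hnext _ hc.2⟩
        | exact ⟨hC _ hc.1, hnext _ hc.2.1, hH _ hc.2.2⟩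
        | exact ⟨hB hc.1, hH _ hc.2⟩
        | exact ⟨hB hc.1, fun a ha => hH _ (hc.2 a ha)⟩
        | exact ⟨hc.1, hc.2.mono hG⟩
        | exact ⟨hH _ hc.1, hc.2⟩

theorem MemOk.congr (h : MemOk s G L) (hf : s'.fresh = s.fresh) (hi : s'.item = s.item)
    (hn : s'.next = s.next) (hh : s'.head = s.head) : MemOk s' G L := by
  constructor
  · rw [hn]; exact h.global
  · exact h.nodupG
  · exact h.nodupL
  · exact h.disj
  · rw [hi]; exact h.own
  · rw [hi]; exact h.alloc
  · rw [hn]; exact h.off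
  · rw [hf, hi]; exact h.fresh
  · rw [hh]; exact h.head

/-- A step of `p` that changes at most `taken` flags and the private data of `p` preserves the
invariant if it preserves the invariant of `p`. -/
theorem Inv.of_private (h : Inv s G L) (p : Place) (hf : s'.fresh = s.fresh)
    (hi : s'.item = s.item) (hn : s'.next = s.next) (hh : s'.head = s.head)
    (hcur : s'.cur = s.cur) (hlast : s'.last = s.last)
    (hother : ∀ q, q ≠ p → s'.pc q = s.pc q ∧ s'.remaining q = s.remaining q ∧
      s'.iter q = s.iter q ∧ s'.pq q = s.pq q)
    (hnl : s.pc p ≠ .pushNewList) (hiter : GNode G (s'.iter p))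
    (hpq : ∀ a ∈ s'.pq p, Held G L a) (hctl : s'.CtlOk G L p (s'.pc p)) : Inv s' G L where
  mem := h.mem.congr hf hi hn hh
  place q := by
    by_cases hq : q = p
    · subst hq
      refine ⟨fun _ => ?_, hiter, hpq, hctl⟩
      rw [hn, hh, hcur, hlast]
      exact (h.place q).list hnl
    · obtain ⟨h1, h2, h3, h4⟩ := hother q hq
      refine (h.place q).mono h1 h2 h3 h4 (fun hp => ?_) rfl (fun _ h => h) (fun _ h => h)
        (by simp [hi]) (by simp [hi]) (by simp [hn]) (fun k a hk => ?_)
      · rw [hn, hh, hcur, hlast]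
        exact ⟨((h.place q).list hp).1, rfl⟩
      · have := (h.place q).ctl
        rw [hk] at this
        exact this.2.1

theorem inv_init : Inv (init Place Task) [] (fun _ => []) where
  mem := by
    constructor <;> simp [init, Linked, Held]
  place p := by
    constructor <;> simp [init, Linked, GNode, Config.CtlOk, Config.BudgetOk, budget]

end Invariant

/-! ### Preservation of the invariant -/

section Preservation

variable {Place Task Prio : Type*} [DecidableEq Place] {s s' : Config Place Task}
  {G : List ℕ} {L : Place → List ℕ}

theorem Inv.goto (h : Inv s G L) {p : Place} {c : PC Place Task} (hnl : s.pc p ≠ .pushNewList)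
    (hctl : s.CtlOk G L p c) : Inv (s.goto p c) G L := by
  refine h.of_private p rfl rfl rfl rfl rfl rfl (fun q hq => by simp [Config.goto, hq]) hnl
    (h.place p).iter (h.place p).pq ?_
  have : (s.goto p c).pc p = c := by simp [Config.goto]
  rw [this]
  cases c <;> exact hctl

theorem Inv.addRef (h : Inv s G L) {p : Place} {a : ℕ} (hnl : s.pc p ≠ .pushNewList)
    (ha : Held G L a) : Inv (s.addRef p a) G L := by
  refine h.of_private p rfl rfl rfl rfl rfl rfl (fun q hq => by simp [Config.addRef, hq]) hnl
    (h.place p).iter (fun b hb => ?_) ?_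
  · simp only [Config.addRef, Function.update_self, Multiset.mem_cons] at hb
    rcases hb with rfl | hb
    · exact ha
    · exact (h.place p).pq b hb
  · have hc := (h.place p).ctl
    have : (s.addRef p a).pc p = s.pc p := rfl
    rw [this]
    generalize s.pc p = c at hc ⊢
    cases c <;> exact hc

theorem Inv.alloc (h : Inv s G L) {p : Place} {k : ℕ} {t : Task} (hpc : s.pc p = .pushNew k t) :
    Inv ((s.alloc ⟨p, k, t⟩).goto p (.pushAdd k s.fresh)) G L := by
  have hne : ∀ a, Held G L a → a ≠ s.fresh := fun a ha => (h.mem.held_lt ha).ne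
  have hitem : ∀ a, Held G L a →
      ((s.alloc ⟨p, k, t⟩).goto p (.pushAdd k s.fresh)).item a = s.item a := by
    intro a ha
    simp [Config.alloc, Config.goto, hne a ha]
  refine ⟨⟨h.mem.global, h.mem.nodupG, h.mem.nodupL, h.mem.disj, ?_, ?_, h.mem.off, ?_,
    h.mem.head⟩, ?_⟩
  · intro q a ha
    rw [hitem a (.inr ⟨q, ha⟩)]
    exact h.mem.own q a ha
  · intro a ha
    rw [hitem a (.inl ha)]
    exact h.mem.alloc a ha
  · intro a ha
    have ha' : s.fresh + 1 ≤ a := ha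
    have : a ≠ s.fresh := by omega
    simp [Config.alloc, Config.goto, this, h.mem.fresh a (by omega)]
  · intro q
    by_cases hq : q = p
    · subst hq
      refine ⟨fun _ => (h.place q).list (by simp [hpc]), (h.place q).iter, (h.place q).pq, ?_⟩
      have hc := (h.place q).ctl
      rw [hpc] at hc
      have hk := Config.map_kOf_congr (M := L q) fun a ha => hitem a (.inr ⟨q, ha⟩)
      simp only [Config.CtlOk, Config.BudgetOk, Config.goto, Function.update_self] at hc ⊢
      simp only [Config.goto] at hk
      refine ⟨?_, fun hh => hne _ hh rfl, t, by simp [Config.alloc]⟩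
      rw [hk]
      exact hc
    · refine (h.place q).mono (by simp [Config.goto, Config.alloc, hq]) rfl rfl rfl
        (fun hp => ⟨((h.place q).list hp).1, rfl⟩) rfl (fun _ h => h) (fun _ h => h) ?_
        (fun a ha => hitem a (.inr ⟨q, ha⟩)) (fun _ h => h) ?_
      · intro a d hd
        have : a ≠ s.fresh := by
          rintro rfl
          simp [h.mem.fresh _ le_rfl] at hd
        simpa [Config.goto, Config.alloc, this] using hd
      · intro k' a hk
        have := (h.place q).ctl
        rw [hk] at this
        exact this.2.1

/-- Linking an item to the end of a local list that has not been published. -/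
theorem Inv.link (h : Inv s G L) {p : Place} {k a : ℕ} (hpc : s.pc p = .pushAdd k a) :
    Inv ((s.link p a).goto p (.pushRef k a)) G (Function.update L p (L p ++ [a])) := by
  have hc := h.ctl hpc
  obtain ⟨hB, hna, t, hta⟩ := hc
  obtain ⟨hl, hlast⟩ := (h.place p).list (by simp [hpc])
  have haoff : s.next (.item a) = none := h.mem.off a hna
  have haG : a ∉ G := fun ha => hna (.inl ha)
  have haL : ∀ q, a ∉ L q := fun q ha => hna (.inr ⟨q, ha⟩)
  set L' := Function.update L p (L p ++ [a]) with hL'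
  have hL'p : L' p = L p ++ [a] := by simp [hL']
  have hL'q : ∀ q, q ≠ p → L' q = L q := fun q hq => by simp [hL', hq]
  have hheld : ∀ b, Held G L' b ↔ Held G L b ∨ b = a := by
    intro b
    constructor
    · rintro (hb | ⟨q, hb⟩)
      · exact .inl (.inl hb)
      · by_cases hq : q = p
        · subst hq
          rw [hL'p, List.mem_append, List.mem_singleton] at hb
          exact hb.imp_left fun hb => .inr ⟨q, hb⟩
        · rw [hL'q q hq] at hb
          exact .inl (.inr ⟨q, hb⟩)
    · rintro ((hb | ⟨q, hb⟩) | rfl)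
      · exact .inl hb
      · refine .inr ⟨q, ?_⟩
        by_cases hq : q = p
        · subst hq
          rw [hL'p]
          simp [hb]
        · rwa [hL'q q hq]
      · exact .inr ⟨p, by simp [hL'p]⟩
  -- The effect of the write on the shared memory, in both cases of `Config.link`.
  obtain ⟨hf, hi, hcur, hrem, hpq, hiter, hpcs, hlastp, hlastq, hnext, hnextL, hheadq, hlp,
      hheads⟩ :
      (s.link p a).fresh = s.fresh ∧ (s.link p a).item = s.item ∧ (s.link p a).cur = s.cur ∧
      (s.link p a).remaining = s.remaining ∧ (s.link p a).pq = s.pq ∧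
      (s.link p a).iter = s.iter ∧ (s.link p a).pc = s.pc ∧
      (s.link p a).last p = some a ∧ (∀ q, q ≠ p → (s.link p a).last q = s.last q) ∧
      (∀ x, s.next x ≠ none → (s.link p a).next x = s.next x) ∧
      (∀ x, (∀ b ∈ L p, x ≠ .item b) → (s.link p a).next x = s.next x) ∧
      (∀ q, q ≠ p → (s.link p a).head (q, s.cur q) = s.head (q, s.cur q)) ∧
      Linked (s.link p a).next ((s.link p a).head (p, s.cur p)) (L p ++ [a]) ∧
      (∀ l b, (s.link p a).head l = some b → s.head l = some b ∨ b = a) := by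
    rcases hlp : s.last p with _ | b
    · have hnil : L p = [] := by
        rw [hlp] at hlast
        exact List.getLast?_eq_none_iff.1 hlast.symm
      simp only [Config.link, hlp, hnil]
      refine ⟨trivial, trivial, trivial, trivial, trivial, trivial, trivial, by simp,
        fun q hq => by simp [hq], fun _ _ => trivial, fun _ _ => trivial, fun q hq => ?_, ?_, ?_⟩
      · rw [Function.update_of_ne]
        exact fun he => hq (congrArg Prod.fst he)
      · simp [Linked, haoff]
      · intro l b hb
        by_cases hl' : l = (p, s.cur p)
        · subst hl'
          simp only [Function.update_self, Option.some.injEq] at hb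
          exact .inr hb.symm
        · rw [Function.update_of_ne hl'] at hb
          exact .inl hb
    · rw [hlp] at hlast
      have hbL : b ∈ L p := List.mem_of_getLast? hlast.symm
      have hbn : s.next (.item b) = none := by
        rcases hn : s.next (.item b) with _ | c
        · rfl
        · exfalso
          -- the last item of a list has no successor
          obtain ⟨M, hM⟩ := List.getLast?_eq_some_iff.1 hlast.symm
          have hcL := hl.next_mem hbL hn
          have key : ∀ (M : List ℕ) (o : Option ℕ), Linked s.next o (M ++ [b]) →
              s.next (.item b) = none := by
            intro M
            induction M with
            | nil => exact fun o ho => ho.2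
            | cons d M ih => exact fun o ho => ih _ ho.2
          rw [hM] at hl
          rw [key _ _ hl] at hn
          simp at hn
      have hab : a ≠ b := by
        rintro rfl
        exact haL p hbL
      simp only [Config.link, hlp]
      refine ⟨trivial, trivial, trivial, trivial, trivial, trivial, trivial, by simp,
        fun q hq => by simp [hq], fun x hx => ?_, fun x hx => ?_, fun _ _ => trivial, ?_,
        fun _ _ h => .inl h⟩
      · rw [Function.update_of_ne]
        rintro rfl
        exact hx hbn
      · rw [Function.update_of_ne (hx b hbL)]
      · refine hl.append hlast.symm (h.mem.nodupL p) (fun c _ hcb => ?_) ?_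
        · rw [Function.update_of_ne]
          simpa using hcb
        · rw [Function.update_self]
          refine ⟨rfl, ?_⟩
          rw [Function.update_of_ne (by simpa using hab)]
          exact haoff
  refine ⟨⟨?_, h.mem.nodupG, ?_, ?_, ?_, ?_, ?_, ?_, ?_⟩, ?_⟩
  · change Linked (s.link p a).next ((s.link p a).next .root) G
    rw [hnextL .root (by simp)]
    refine h.mem.global.congr fun b hb => hnextL _ fun c hc => ?_
    simp only [ne_eq, Node.item.injEq]
    rintro rfl
    exact h.mem.disj p b hc hb
  · intro q
    by_cases hq : q = p
    · subst hq
      rw [hL'p, List.nodup_append]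
      refine ⟨h.mem.nodupL q, by simp, ?_⟩
      intro b hb c hc
      rw [List.mem_singleton] at hc
      subst hc
      rintro rfl
      exact haL q hb
    · rw [hL'q q hq]
      exact h.mem.nodupL q
  · intro q b hb hbG
    by_cases hq : q = p
    · subst hq
      rw [hL'p, List.mem_append, List.mem_singleton] at hb
      rcases hb with hb | rfl
      · exact h.mem.disj q b hb hbG
      · exact haG hbG
    · rw [hL'q q hq] at hb
      exact h.mem.disj q b hb hbG
  · intro q b hb
    change ∃ d, (s.link p a).item b = some d ∧ d.place = q
    rw [hi]
    by_cases hq : q = p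
    · subst hq
      rw [hL'p, List.mem_append, List.mem_singleton] at hb
      rcases hb with hb | rfl
      · exact h.mem.own q b hb
      · exact ⟨_, hta, rfl⟩
    · rw [hL'q q hq] at hb
      exact h.mem.own q b hb
  · change ∀ b ∈ G, ∃ d, (s.link p a).item b = some d
    rw [hi]
    exact h.mem.alloc
  · intro b hb
    change (s.link p a).next (.item b) = none
    rw [hheld, not_or] at hb
    rw [hnextL, h.mem.off b hb.1]
    intro c hc he
    cases he
    exact hb.1 (.inr ⟨p, hc⟩)
  · change ∀ b, (s.link p a).fresh ≤ b → (s.link p a).item b = none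
    rw [hi, hf]
    exact h.mem.fresh
  · intro l b hb
    rw [hheld]
    exact (hheads l b hb).imp_left (h.mem.head l b)
  · intro q
    by_cases hq : q = p
    · subst hq
      refine ⟨fun _ => ?_, ?_, ?_, ?_⟩
      · change Linked (s.link q a).next ((s.link q a).head (q, (s.link q a).cur q)) (L' q) ∧
          (s.link q a).last q = (L' q).getLast?
        rw [hL'p, hcur, hlastp]
        exact ⟨hlp, by simp⟩
      · change GNode G ((s.link q a).iter q)
        rw [hiter]
        exact (h.place q).iter
      · change ∀ b ∈ (s.link q a).pq q, _
        rw [hpq]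
        exact fun b hb => (hheld b).2 (.inl ((h.place q).pq b hb))
      · have : ((s.link q a).goto q (.pushRef k a)).pc q = .pushRef k a := by simp [Config.goto]
        rw [this]
        refine ⟨(hheld a).2 (.inr rfl), by simp [hL'p], ?_⟩
        have hk : ((s.link q a).goto q (.pushRef k a)).kOf = s.kOf := by
          funext b
          change (((s.link q a).item b).map ItemData.k).getD 0 = _
          rw [hi]
          rfl
        have hka : s.kOf a = k := by simp [Config.kOf, hta]
        change min ((s.link q a).remaining q - 1) _ = _
        rw [hk, hL'p, List.map_append, List.map_singleton, hka, budget_append, hrem, hB.1]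
    · refine (h.place q).mono (by simp [Config.goto, hq, hpcs]) (congrFun hrem q)
        (congrFun hiter q) (congrFun hpq q) (fun hp => ⟨?_, hlastq q hq⟩) (hL'q q hq)
        (fun _ h => h) (fun b hb => (hheld b).2 (.inl hb)) (fun b d hd => ?_)
        (fun b _ => congrFun hi b) (fun x hx => ?_) (fun k' b hb => ?_)
      · change Linked (s.link p a).next ((s.link p a).head (q, (s.link p a).cur q)) (L q)
        rw [hcur, hheadq q hq]
        refine ((h.place q).list hp).1.congr fun b hb => hnextL _ fun c hc he => ?_
        cases he
        obtain ⟨d, hd, hdp⟩ := h.mem.own p b hc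
        obtain ⟨d', hd', hdq⟩ := h.mem.own q b hb
        cases hd.symm.trans hd'
        exact hq (hdq.symm.trans hdp)
      · change (s.link p a).item b = some d
        rwa [hi]
      · change (s.link p a).next x ≠ none
        rwa [hnext x hx]
      · have hq' := (h.place q).ctl
        rw [hb] at hq'
        obtain ⟨-, hnb, t', ht'⟩ := hq'
        rw [hheld, not_or]
        refine ⟨hnb, ?_⟩
        rintro rfl
        rw [hta] at ht'
        cases ht'
        exact hq rfl

/-- Appending a local list to the global list. -/
theorem Inv.publish (h : Inv s G L) {p : Place} {v : Node} (hpc : s.pc p = .pushCAS v)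
    (hv : s.next v = none) :
    Inv ({ s with next := Function.update s.next v (s.head (p, s.cur p)) }.goto p .pushNewList)
      (G ++ L p) (Function.update L p []) := by
  have hc := h.ctl hpc
  obtain ⟨hne, hvG⟩ := hc
  obtain ⟨hl, hlast⟩ := (h.place p).list (by simp [hpc])
  set L' := Function.update L p [] with hL'
  have hL'p : L' p = [] := by simp [hL']
  have hL'q : ∀ q, q ≠ p → L' q = L q := fun q hq => by simp [hL', hq]
  have hheld : ∀ b, Held (G ++ L p) L' b ↔ Held G L b := by
    intro b
    constructor
    · rintro (hb | ⟨q, hb⟩)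
      · exact (List.mem_append.1 hb).imp_right fun hb => ⟨p, hb⟩
      · by_cases hq : q = p
        · subst hq
          simp [hL'p] at hb
        · rw [hL'q q hq] at hb
          exact .inr ⟨q, hb⟩
    · rintro (hb | ⟨q, hb⟩)
      · exact .inl (List.mem_append_left _ hb)
      · by_cases hq : q = p
        · subst hq
          exact .inl (List.mem_append_right _ hb)
        · exact .inr ⟨q, by rwa [hL'q q hq]⟩
  have hvL : ∀ q, ∀ b ∈ L q, Node.item b ≠ v := by
    rintro q b hb rfl
    rcases hvG with hr | ⟨c, hcG, hbc⟩
    · cases hr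
    · cases hbc
      exact h.mem.disj q b hb hcG
  have hLc : ∀ q o, Linked s.next o (L q) →
      Linked (Function.update s.next v (s.head (p, s.cur p))) o (L q) :=
    fun q o ho => ho.congr fun b hb => Function.update_of_ne (hvL q b hb) _ _
  refine ⟨⟨?_, ?_, ?_, ?_, ?_, ?_, ?_, h.mem.fresh, ?_⟩, ?_⟩
  · change Linked (Function.update s.next v (s.head (p, s.cur p)))
      (Function.update s.next v (s.head (p, s.cur p)) .root) (G ++ L p)
    rcases hvG with rfl | ⟨b, hb, rfl⟩
    · have hG : G = [] := h.mem.global.unique (show Linked s.next _ [] from hv)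
      rw [hG, Function.update_self]
      exact hLc p _ hl
    · rw [Function.update_of_ne (by simp)]
      refine h.mem.global.append (h.mem.global.getLast?_of_next_eq_none hb hv) h.mem.nodupG
        (fun c _ hcb => Function.update_of_ne (by simpa using hcb) _ _) ?_
      rw [Function.update_self]
      exact hLc p _ hl
  · rw [List.nodup_append]
    refine ⟨h.mem.nodupG, h.mem.nodupL p, ?_⟩
    rintro b hb c hc rfl
    exact h.mem.disj p b hc hb
  · intro q
    by_cases hq : q = p
    · subst hq
      simp [hL'p]
    · rw [hL'q q hq]
      exact h.mem.nodupL q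
  · intro q b hb
    by_cases hq : q = p
    · subst hq
      simp [hL'p] at hb
    · rw [hL'q q hq] at hb
      rw [List.mem_append, not_or]
      refine ⟨h.mem.disj q b hb, fun hbp => ?_⟩
      obtain ⟨d, hd, hdp⟩ := h.mem.own p b hbp
      obtain ⟨d', hd', hdq⟩ := h.mem.own q b hb
      cases hd.symm.trans hd'
      exact hq (hdq.symm.trans hdp)
  · intro q b hb
    by_cases hq : q = p
    · subst hq
      simp [hL'p] at hb
    · rw [hL'q q hq] at hb
      exact h.mem.own q b hb
  · intro b hb
    exact h.mem.held_alloc ((hheld b).1 (.inl hb))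
  · intro b hb
    rw [hheld] at hb
    change Function.update s.next v (s.head (p, s.cur p)) (.item b) = none
    rw [Function.update_of_ne, h.mem.off b hb]
    rintro rfl
    rcases hvG with hr | ⟨c, hcG, hbc⟩
    · cases hr
    · cases hbc
      exact hb (.inl hcG)
  · intro l b hb
    exact (hheld b).2 (h.mem.head l b hb)
  · intro q
    by_cases hq : q = p
    · subst hq
      refine ⟨fun hp => absurd (by simp [Config.goto]) hp,
        (h.place q).iter.mono (List.subset_append_left _ _),
        fun b hb => (hheld b).2 ((h.place q).pq b hb), ?_⟩
      simp only [Config.goto, Function.update_self]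
      exact hL'p
    · refine (h.place q).mono (by simp [Config.goto, hq]) rfl rfl rfl
        (fun hp => ⟨hLc q _ ((h.place q).list hp).1, rfl⟩) (hL'q q hq)
        (List.subset_append_left _ _) (fun b hb => (hheld b).2 hb) (fun _ _ h => h)
        (fun _ _ => rfl) (fun x hx => ?_) (fun k b hb => ?_)
      · change Function.update s.next v (s.head (p, s.cur p)) x ≠ none
        rw [Function.update_of_ne]
        · exact hx
        · rintro rfl
          exact hx hv
      · have := (h.place q).ctl
        rw [hb] at this
        rw [hheld]
        exact this.2.1

theorem Inv.newList (h : Inv s G L) {p : Place} (hpc : s.pc p = .pushNewList) :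
    Inv ({ s with
            cur := Function.update s.cur p (s.cur p + 1)
            head := Function.update s.head (p, s.cur p + 1) none
            last := Function.update s.last p none }.goto p .pushReset) G L := by
  have hc := h.ctl hpc
  have hL : L p = [] := hc
  refine ⟨⟨h.mem.global, h.mem.nodupG, h.mem.nodupL, h.mem.disj, h.mem.own, h.mem.alloc,
    h.mem.off, h.mem.fresh, ?_⟩, ?_⟩
  · intro l b hb
    change Function.update s.head (p, s.cur p + 1) none l = some b at hb
    by_cases hl : l = (p, s.cur p + 1)
    · subst hl
      simp at hb
    · rw [Function.update_of_ne hl] at hb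
      exact h.mem.head l b hb
  · intro q
    by_cases hq : q = p
    · subst hq
      refine ⟨fun _ => ?_, (h.place q).iter, (h.place q).pq, ?_⟩
      · simp [Config.goto, hL, Linked]
      · simp only [Config.goto, Function.update_self]
        exact hL
    · refine (h.place q).mono (by simp [Config.goto, hq]) rfl rfl rfl (fun hp => ?_) rfl
        (fun _ h => h) (fun _ h => h) (fun _ _ h => h) (fun _ _ => rfl) (fun _ h => h)
        (fun k b hb => ?_)
      · simp only [Config.goto, Function.update_of_ne hq]
        rw [Function.update_of_ne fun he => hq (congrArg Prod.fst he)]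
        exact ⟨((h.place q).list hp).1, trivial⟩
      · have := (h.place q).ctl
        rw [hb] at this
        exact this.2.1

variable [LinearOrder Prio] {prio : Task → Prio} {ev : Event Place Task}

/-- Every step preserves the invariant, and the linked items change by insertions only. -/
theorem Inv.step (h : Inv s G L) (st : Step prio s ev s') :
    ∃ G' L', Inv s' G' L' ∧ ∀ a, Held G' L' a ↔ Held G L a ∨ ∃ p, ev = .insert p a := by
  have keep : ∀ {ev : Event Place Task}, (∀ p a, ev ≠ .insert p a) → Inv s' G L →
      ∃ G' L', Inv s' G' L' ∧ ∀ a, Held G' L' a ↔ Held G L a ∨ ∃ p, ev = .insert p a :=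
    fun hev hi => ⟨G, L, hi, fun a => by simp [hev]⟩
  cases st with
  | invPush p k t hpc =>
    have hc := h.ctl hpc
    exact keep (by simp) (h.goto (by simp [hpc]) hc)
  | pushNew p k t hpc => exact keep (by simp) (h.alloc hpc)
  | pushAdd p k a hpc =>
    refine ⟨_, _, h.link hpc, fun b => ?_⟩
    simp only [Event.insert.injEq]
    constructor
    · rintro (hb | ⟨q, hb⟩)
      · exact .inl (.inl hb)
      · by_cases hq : q = p
        · subst hq
          rw [Function.update_self, List.mem_append, List.mem_singleton] at hb
          rcases hb with hb | rfl
          · exact .inl (.inr ⟨q, hb⟩)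
          · exact .inr ⟨q, rfl, rfl⟩
        · rw [Function.update_of_ne hq] at hb
          exact .inl (.inr ⟨q, hb⟩)
    · rintro ((hb | ⟨q, hb⟩) | ⟨q, -, rfl⟩)
      · exact .inl hb
      · refine .inr ⟨q, ?_⟩
        by_cases hq : q = p
        · subst hq
          simp [hb]
        · rwa [Function.update_of_ne hq]
      · exact .inr ⟨p, by simp⟩
  | pushRef p k a hpc =>
    have hc := h.ctl hpc
    exact keep (by simp) ((h.addRef (by simp [hpc]) hc.1).goto (by simp [Config.addRef, hpc]) hc.2)
  | pushCount p k r hpc hr =>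
    have hc := h.ctl hpc
    refine keep (by simp) (h.of_private p rfl rfl rfl rfl rfl rfl
      (fun q hq => by simp [Config.goto, hq]) (by simp [hpc]) (h.place p).iter (h.place p).pq ?_)
    simp only [Config.goto, Function.update_self]
    split_ifs with h0
    · exact hc.1
    · have hb : r = budget ((L p).map s.kOf) := hr.trans hc.2
      refine ⟨?_, ?_⟩
      · simp only [Function.update_self]
        exact hb
      · exact pos_iff_ne_zero.2 fun h' => h0 (hb.trans h')
  | pushTail p v hpc hv =>
    have hc := h.ctl hpc
    exact keep (by simp) (h.goto (by simp [hpc]) ⟨hc, h.mem.reach_gnode (.inl rfl) hv.1⟩)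
  | pushCAS_success p v hpc hv =>
    refine ⟨_, _, h.publish hpc hv, fun b => ?_⟩
    simp only [reduceCtorEq, exists_false, or_false]
    constructor
    · rintro (hb | ⟨q, hb⟩)
      · exact (List.mem_append.1 hb).imp_right fun hb => ⟨p, hb⟩
      · by_cases hq : q = p
        · subst hq
          simp at hb
        · rw [Function.update_of_ne hq] at hb
          exact .inr ⟨q, hb⟩
    · rintro (hb | ⟨q, hb⟩)
      · exact .inl (List.mem_append_left _ hb)
      · by_cases hq : q = p
        · subst hq
          exact .inl (List.mem_append_right _ hb)
        · exact .inr ⟨q, by rwa [Function.update_of_ne hq]⟩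
  | pushCAS_failure p v hpc hv =>
    have hc := h.ctl hpc
    exact keep (by simp) (h.goto (by simp [hpc]) hc.1)
  | pushNewList p hpc => exact keep (by simp) (h.newList hpc)
  | pushReset p hpc =>
    have hc := h.ctl hpc
    refine keep (by simp) (h.of_private p rfl rfl rfl rfl rfl rfl
      (fun q hq => by simp [Config.goto, hq]) (by simp [hpc]) (h.place p).iter (h.place p).pq ?_)
    simp only [Config.goto, Function.update_self]
    have hL : L p = [] := hc
    simp [Config.CtlOk, Config.BudgetOk, hL, budget]
  | pushRet p hpc =>
    have hc := h.ctl hpc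
    exact keep (by simp) (h.goto (by simp [hpc]) hc)
  | glTest_done p c hpc hv =>
    have hc := h.ctl hpc
    refine keep (by simp) (h.goto (by simp [hpc]) ?_)
    cases c <;> exact hc
  | glTest_more p c v hpc hv hne =>
    have hc := h.ctl hpc
    exact keep (by simp) (h.goto (by simp [hpc])
      ⟨hc, h.mem.next_ne_none (h.place p).iter hv hne⟩)
  | glItem_own p c a d hpc hn hd hp =>
    have hc := h.ctl hpc
    exact keep (by simp) (h.goto (by simp [hpc]) hc)
  | glItem_other p c a d hpc hn hd hp =>
    have hc := h.ctl hpc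
    exact keep (by simp) (h.goto (by simp [hpc])
      ⟨hc.1, hc.2, .inl (h.mem.gnode_next (h.place p).iter hn)⟩)
  | glTaken_skip p c a hpc ht =>
    have hc := h.ctl hpc
    exact keep (by simp) (h.goto (by simp [hpc]) ⟨hc.1, hc.2.1⟩)
  | glTaken_add p c a hpc ht =>
    have hc := h.ctl hpc
    refine keep (by simp) ((h.addRef (by simp [hpc]) hc.2.2).goto
      (by simp [Config.addRef, hpc]) ⟨?_, hc.2.1⟩)
    cases c <;> exact hc.1
  | glNext p c a hpc hn =>
    have hc := h.ctl hpc
    refine keep (by simp) (h.of_private p rfl rfl rfl rfl rfl rfl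
      (fun q hq => by simp [Config.goto, hq]) (by simp [hpc]) ?_ (h.place p).pq ?_)
    · simp only [Config.goto, Function.update_self]
      exact .inr ⟨a, h.mem.gnode_next (h.place p).iter hn, rfl⟩
    · simp only [Config.goto, Function.update_self]
      cases c <;> exact hc.1
  | invPop p hpc =>
    have hc := h.ctl hpc
    exact keep (by simp) (h.goto (by simp [hpc]) hc)
  | popTest_empty p hpc h0 =>
    have hc := h.ctl hpc
    exact keep (by simp) (h.goto (by simp [hpc]) hc)
  | popTest_pop p a hpc ha hmax =>
    have hc := h.ctl hpc
    refine keep (by simp) (h.of_private p rfl rfl rfl rfl rfl rfl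
      (fun q hq => by simp [Config.goto, hq]) (by simp [hpc]) (h.place p).iter (fun b hb => ?_) ?_)
    · simp only [Config.goto, Function.update_self] at hb
      exact (h.place p).pq b (Multiset.mem_of_mem_erase hb)
    · simp only [Config.goto, Function.update_self]
      exact ⟨hc, (h.place p).pq a ha⟩
  | popCheck_taken p a hpc ht =>
    have hc := h.ctl hpc
    exact keep (by simp) (h.goto (by simp [hpc]) hc.1)
  | popCheck_free p a d hpc ht hd =>
    have hc := h.ctl hpc
    exact keep (by simp) (h.goto (by simp [hpc]) ⟨hc.1, hc.2, d, hd, rfl⟩)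
  | popTAS_success p a t hpc ht =>
    have hc := h.ctl hpc
    refine keep (by simp) (h.of_private p rfl rfl rfl rfl rfl rfl
      (fun q hq => by simp [Config.goto, hq]) (by simp [hpc]) (h.place p).iter (h.place p).pq ?_)
    simp only [Config.goto, Function.update_self]
    exact hc.1
  | popTAS_failure p a t hpc ht =>
    have hc := h.ctl hpc
    exact keep (by simp) (h.goto (by simp [hpc]) hc.1)
  | spyPick p victim hpc =>
    have hc := h.ctl hpc
    exact keep (by simp) (h.goto (by simp [hpc]) hc)
  | spyHead p l hpc =>
    have hc := h.ctl hpc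
    exact keep (by simp) (h.goto (by simp [hpc]) ⟨hc, fun a ha => h.mem.head l a ha⟩)
  | spyAt_end p hpc =>
    have hc := h.ctl hpc
    exact keep (by simp) (h.goto (by simp [hpc]) hc.1)
  | spyAt_own p a d hpc hd hp =>
    have hc := h.ctl hpc
    exact keep (by simp) (h.goto (by simp [hpc]) ⟨hc.1, hc.2 a rfl⟩)
  | spyAt_other p a d hpc hd hp =>
    have hc := h.ctl hpc
    exact keep (by simp) (h.goto (by simp [hpc]) ⟨hc.1, hc.2 a rfl⟩)
  | spyTaken_skip p a hpc ht =>
    have hc := h.ctl hpc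
    exact keep (by simp) (h.goto (by simp [hpc]) hc)
  | spyTaken_add p a hpc ht =>
    have hc := h.ctl hpc
    exact keep (by simp) ((h.addRef (by simp [hpc]) hc.2).goto (by simp [Config.addRef, hpc]) hc)
  | spyNext p a hpc =>
    have hc := h.ctl hpc
    exact keep (by simp) (h.goto (by simp [hpc])
      ⟨hc.1, fun b hb => h.held_next hc.2 hb⟩)
  | popLoop_again p hpc h0 =>
    have hc := h.ctl hpc
    exact keep (by simp) (h.goto (by simp [hpc]) hc)
  | popLoop_fail p hpc h0 =>
    have hc := h.ctl hpc
    exact keep (by simp) (h.goto (by simp [hpc]) hc)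
  | popRet p r hpc =>
    have hc := h.ctl hpc
    exact keep (by simp) (h.goto (by simp [hpc]) hc)

end Preservation

/-! ### Lock-freedom of `push` -/

section Rank

variable {Place Task : Type*} {s : Config Place Task} {G : List ℕ} {L : Place → List ℕ}

/-- The number of phases that a `push` at this control state has still to go through; `9` outside
`push`, so that an invocation decreases the value, too. -/
def PC.stage : PC Place Task → ℕ
  | .pushNew _ _ => 8
  | .pushAdd _ _ => 7
  | .pushRef _ _ => 6
  | .pushCount _ => 5
  | .pushTail | .pushCAS _ => 4
  | .glTest .inPush | .glItem .inPush | .glTaken .inPush _ | .glNext .inPush => 4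
  | .pushNewList => 3
  | .pushReset => 2
  | .pushRet => 1
  | _ => 9

theorem PC.inPush_iff (c : PC Place Task) : c.InPush ↔ c.stage ≠ 9 := by
  cases c with
  | glTest c => cases c <;> simp [PC.InPush, PC.stage]
  | glItem c => cases c <;> simp [PC.InPush, PC.stage]
  | glTaken c a => cases c <;> simp [PC.InPush, PC.stage]
  | glNext c => cases c <;> simp [PC.InPush, PC.stage]
  | _ => simp [PC.InPush, PC.stage]

open Classical in
/-- The number of nodes that follow `x`. -/
noncomputable def rest (next : Node → Option ℕ) (x : Node) : ℕ :=
  if h : ∃ M, Linked next (next x) M then h.choose.length else 0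

theorem rest_eq {next : Node → Option ℕ} {x : Node} {M : List ℕ} (h : Linked next (next x) M) :
    rest next x = M.length := by
  have hex : ∃ M, Linked next (next x) M := ⟨M, h⟩
  rw [rest, dif_pos hex, hex.choose_spec.unique h]

theorem MemOk.rest_next (h : MemOk s G L) {v : Node} (hv : GNode G v) {a : ℕ}
    (ha : s.next v = some a) : rest s.next v = rest s.next (.item a) + 1 := by
  obtain ⟨M, hM⟩ := h.global.suffix (h.gnode_next hv ha)
  have hv' : Linked s.next (s.next v) (a :: M) := ⟨ha, hM⟩
  rw [rest_eq hM, rest_eq hv', List.length_cons]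

open Classical in
/-- A bound on the number of steps that a place in the loop of a `push` takes until its CAS
succeeds, provided that the `next` pointers do not change. -/
noncomputable def loopRank (next : Node → Option ℕ) (x : Node) : PC Place Task → ℕ
  | .pushCAS v => if next v = none then 0 else 4 * rest next x + 3
  | .pushTail => 1
  | .glTest .inPush => 4 * rest next x + 2
  | .glItem .inPush => 4 * rest next x + 1
  | .glTaken .inPush _ => 4 * rest next x
  | .glNext .inPush => 4 * rest next x - 1
  | _ => 0

theorem loopRank_eq_zero {c : PC Place Task} (h : c.stage = 9) (next : Node → Option ℕ)
    (x : Node) : loopRank next x c = 0 := by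
  cases c with
  | glTest c => cases c <;> simp_all [loopRank, PC.stage]
  | glItem c => cases c <;> simp_all [loopRank, PC.stage]
  | glTaken c a => cases c <;> simp_all [loopRank, PC.stage]
  | glNext c => cases c <;> simp_all [loopRank, PC.stage]
  | _ => simp_all [loopRank, PC.stage]

end Rank

section Progress

variable {Place Task Prio : Type*} [DecidableEq Place] [LinearOrder Prio] {prio : Task → Prio}
  {s s' : Config Place Task} {ev : Event Place Task} {G : List ℕ} {L : Place → List ℕ}

/-- Every configuration of an execution satisfies the invariant. -/
theorem IsExec.inv {s : ℕ → Config Place Task} {e : ℕ → Event Place Task} {n : ℕ}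
    (h : IsExec prio s e n) {j : ℕ} (hj : j ≤ n) : ∃ G L, Inv (s j) G L := by
  induction j with
  | zero =>
    rw [h.1]
    exact ⟨_, _, inv_init⟩
  | succ j ih =>
    obtain ⟨G, L, hi⟩ := ih (by omega)
    obtain ⟨G', L', hi', -⟩ := hi.step (h.2 j (by omega))
    exact ⟨G', L', hi'⟩

/-- A place inside a `push` is never blocked. -/
theorem Inv.exists_step (h : Inv s G L) {p : Place} (hp : (s.pc p).InPush) :
    ∃ (ev : Event Place Task) (s' : Config Place Task), ev.place = p ∧ Step prio s ev s' := by
  have hc := (h.place p).ctl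
  have hi := (h.place p).iter
  generalize hpc : s.pc p = c at hc hp
  have item : ∀ {a : ℕ}, s.next (s.iter p) = some a → ∃ d, s.item a = some d :=
    fun ha => h.mem.alloc _ (h.mem.gnode_next hi ha)
  cases c with
  | pushNew k t => exact ⟨_, _, rfl, .pushNew s p k t hpc⟩
  | pushAdd k a => exact ⟨_, _, rfl, .pushAdd s p k a hpc⟩
  | pushRef k a => exact ⟨_, _, rfl, .pushRef s p k a hpc⟩
  | pushCount k => exact ⟨_, _, rfl, .pushCount s p k _ hpc rfl⟩
  | pushTail =>
    obtain ⟨v, hv⟩ := h.mem.exists_tail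
    exact ⟨_, _, rfl, .pushTail s p v hpc hv⟩
  | pushCAS v =>
    by_cases hv : s.next v = none
    · exact ⟨_, _, rfl, .pushCAS_success s p v hpc hv⟩
    · exact ⟨_, _, rfl, .pushCAS_failure s p v hpc hv⟩
  | pushNewList => exact ⟨_, _, rfl, .pushNewList s p hpc⟩
  | pushReset => exact ⟨_, _, rfl, .pushReset s p hpc⟩
  | pushRet => exact ⟨_, _, rfl, .pushRet s p hpc⟩
  | glTest c =>
    obtain ⟨v, hv⟩ := h.mem.exists_tail
    by_cases hne : s.iter p = v
    · exact ⟨_, _, rfl, .glTest_done s p c hpc (hne ▸ hv)⟩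
    · exact ⟨_, _, rfl, .glTest_more s p c v hpc hv hne⟩
  | glItem c =>
    obtain ⟨a, ha⟩ := Option.ne_none_iff_exists'.1 hc.2
    obtain ⟨d, hd⟩ := item ha
    by_cases hdp : d.place = p
    · exact ⟨_, _, rfl, .glItem_own s p c a d hpc ha hd hdp⟩
    · exact ⟨_, _, rfl, .glItem_other s p c a d hpc ha hd hdp⟩
  | glTaken c a =>
    rcases ht : s.taken a with _ | _
    · exact ⟨_, _, rfl, .glTaken_add s p c a hpc ht⟩
    · exact ⟨_, _, rfl, .glTaken_skip s p c a hpc ht⟩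
  | glNext c =>
    obtain ⟨a, ha⟩ := Option.ne_none_iff_exists'.1 hc.2
    exact ⟨_, _, rfl, .glNext s p c a hpc ha⟩
  | _ => exact hp.elim

/-- A step changes the control state and the iterator of no other place. -/
theorem Step.other (st : Step prio s ev s') {q : Place} (hq : q ≠ ev.place) :
    s'.pc q = s.pc q ∧ s'.iter q = s.iter q ∧ s'.remaining q = s.remaining q := by
  cases st with
  | pushAdd p k a hpc =>
    simp only [Event.place] at hq
    simp only [Config.goto, Function.update_of_ne hq]
    unfold Config.link
    split <;> exact ⟨rfl, rfl, rfl⟩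
  | _ =>
    simp only [Event.place] at hq
    simp [Config.goto, Config.alloc, Config.addRef, hq]

/-- Every step other than the response of a `push` decreases the stage of its place, or it keeps
the stage and the `next` pointers and, if it belongs to a `push`, decreases the rank. -/
theorem Inv.step_stage (h : Inv s G L) (st : Step prio s ev s') (hev : ∀ p, ev ≠ .retPush p) :
    (s'.pc ev.place).stage < (s.pc ev.place).stage ∨
    ((s'.pc ev.place).stage = (s.pc ev.place).stage ∧ s'.next = s.next ∧
      ((s.pc ev.place).stage ≠ 9 →
        loopRank s'.next (s'.iter ev.place) (s'.pc ev.place) <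
          loopRank s.next (s.iter ev.place) (s.pc ev.place))) := by
  cases st with
  | pushCount p k r hpc hr =>
    left
    by_cases h0 : r = 0 <;> simp [Event.place, Config.goto, hpc, PC.stage, h0]
  | pushTail p v hpc hv =>
    right
    simp [Event.place, Config.goto, hpc, PC.stage, loopRank, hv.2]
  | pushCAS_failure p v hpc hv =>
    right
    simp [Event.place, Config.goto, hpc, PC.stage, loopRank, hv]
  | pushRet p hpc => exact absurd rfl (hev p)
  | glTest_done p c hpc hv =>
    right
    cases c <;> simp [Event.place, Config.goto, hpc, PC.stage, loopRank, Caller.after]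
  | glTest_more p c v hpc hv hne =>
    right
    cases c <;> simp [Event.place, Config.goto, hpc, PC.stage, loopRank]
  | glItem_own p c a d hpc hn hd hp =>
    right
    cases c <;> simp [Event.place, Config.goto, hpc, PC.stage, loopRank]
  | glItem_other p c a d hpc hn hd hp =>
    right
    cases c <;> simp [Event.place, Config.goto, hpc, PC.stage, loopRank]
  | glTaken_skip p c a hpc ht =>
    right
    obtain ⟨b, hb⟩ := Option.ne_none_iff_exists'.1 (h.ctl hpc).2.1
    have := h.mem.rest_next (h.place p).iter hb
    cases c <;> simp [Event.place, Config.goto, hpc, PC.stage, loopRank]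
    omega
  | glTaken_add p c a hpc ht =>
    right
    obtain ⟨b, hb⟩ := Option.ne_none_iff_exists'.1 (h.ctl hpc).2.1
    have := h.mem.rest_next (h.place p).iter hb
    cases c <;> simp [Event.place, Config.goto, Config.addRef, hpc, PC.stage, loopRank]
    omega
  | glNext p c a hpc hn =>
    right
    have := h.mem.rest_next (h.place p).iter hn
    cases c <;> simp [Event.place, Config.goto, hpc, PC.stage, loopRank]
    omega
  | pushAdd p k a hpc =>
    left
    simp [Event.place, Config.goto, hpc, PC.stage]
  | _ =>
    simp_all [Event.place, Config.goto, Config.alloc, Config.addRef, PC.stage, loopRank]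

variable [Fintype Place]

/-- If no `push` responds, then only finitely many steps are taken inside `push` operations: the
sum of the stages is eventually constant, and from then on each such step decreases the sum of the
ranks. -/
theorem pushLockFree (prio : Task → Prio) : PushLockFree Place prio := by
  refine ⟨fun s e n hx p hp => ?_, fun s e hx hinf => ?_⟩
  · obtain ⟨G, L, hi⟩ := hx.inv le_rfl
    exact hi.exists_step hp
  by_contra hfin
  rw [Set.not_infinite] at hfin
  obtain ⟨N, hN⟩ : ∃ N, ∀ n, N ≤ n → ∀ p, e n ≠ .retPush p := by
    obtain ⟨N, hN⟩ := hfin.bddAbove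
    exact ⟨N + 1, fun n hn p hp => by have := hN ⟨p, hp⟩; omega⟩
  have hst : ∀ n, Step prio (s n) (e n) (s (n + 1)) := fun n => (hx (n + 1)).2 n (by omega)
  have hstep : ∀ n, N ≤ n →
      ((s (n + 1)).pc (e n).place).stage < ((s n).pc (e n).place).stage ∨
      (((s (n + 1)).pc (e n).place).stage = ((s n).pc (e n).place).stage ∧
        (s (n + 1)).next = (s n).next ∧ (((s n).pc (e n).place).stage ≠ 9 →
          loopRank (s (n + 1)).next ((s (n + 1)).iter (e n).place) ((s (n + 1)).pc (e n).place) <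
            loopRank (s n).next ((s n).iter (e n).place) ((s n).pc (e n).place))) := fun n hn => by
    obtain ⟨G, L, hi⟩ := (hx n).inv le_rfl
    exact hi.step_stage (hst n) (hN n hn)
  set S : ℕ → ℕ := fun n => ∑ q, ((s n).pc q).stage with hS
  set R : ℕ → ℕ := fun n => ∑ q, loopRank (s n).next ((s n).iter q) ((s n).pc q) with hR
  have hSle : ∀ n, N ≤ n → S (n + 1) ≤ S n := by
    intro n hn
    refine Finset.sum_le_sum fun q _ => ?_
    by_cases hq : q = (e n).place
    · subst hq
      rcases hstep n hn with h | h
      · exact h.le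
      · exact h.1.le
    · rw [((hst n).other hq).1]
  have anti : ∀ (f : ℕ → ℕ) (N : ℕ), (∀ n, N ≤ n → f (n + 1) ≤ f n) →
      ∃ N', N ≤ N' ∧ ∀ n, N' ≤ n → f n = f N' := by
    intro f N hf
    obtain ⟨N', hN', hmin⟩ : ∃ N', N ≤ N' ∧ ∀ n, N ≤ n → f N' ≤ f n :=
      ⟨Function.argminOn f {n | N ≤ n} ⟨N, (le_refl N :)⟩,
        Function.argminOn_mem f {n | N ≤ n} ⟨N, (le_refl N :)⟩,
        fun n hn => Function.argminOn_le f {n | N ≤ n} hn⟩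
    refine ⟨N', hN', fun n hn => le_antisymm ?_ (hmin n (hN'.trans hn))⟩
    induction n, hn using Nat.le_induction with
    | base => exact le_rfl
    | succ n hn ih => exact (hf n (hN'.trans hn)).trans ih
  obtain ⟨N₁, hN₁, hconst⟩ := anti S N hSle
  have hkeep : ∀ n, N₁ ≤ n → (s (n + 1)).next = (s n).next ∧
      ((s (n + 1)).pc (e n).place).stage = ((s n).pc (e n).place).stage ∧
      (((s n).pc (e n).place).stage ≠ 9 →
        loopRank (s (n + 1)).next ((s (n + 1)).iter (e n).place) ((s (n + 1)).pc (e n).place) <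
          loopRank (s n).next ((s n).iter (e n).place) ((s n).pc (e n).place)) := by
    intro n hn
    rcases hstep n (hN₁.trans hn) with h | ⟨h1, h2, h3⟩
    · exfalso
      have : S (n + 1) < S n := by
        refine Finset.sum_lt_sum (fun q _ => ?_) ⟨(e n).place, Finset.mem_univ _, h⟩
        by_cases hq : q = (e n).place
        · subst hq
          exact h.le
        · rw [((hst n).other hq).1]
      rw [hconst n hn, hconst (n + 1) (by omega)] at this
      exact this.false
    · exact ⟨h2, h1, h3⟩
  have hRq : ∀ n, N₁ ≤ n → ∀ q, loopRank (s (n + 1)).next ((s (n + 1)).iter q)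
      ((s (n + 1)).pc q) ≤ loopRank (s n).next ((s n).iter q) ((s n).pc q) := by
    intro n hn q
    obtain ⟨h1, h2, h3⟩ := hkeep n hn
    by_cases hq : q = (e n).place
    · subst hq
      by_cases h9 : ((s n).pc (e n).place).stage = 9
      · rw [loopRank_eq_zero (h2.trans h9)]
        exact Nat.zero_le _
      · exact (h3 h9).le
    · rw [h1, ((hst n).other hq).1, ((hst n).other hq).2.1]
  obtain ⟨N₂, hN₂, hconst'⟩ := anti R N₁ fun n hn => Finset.sum_le_sum fun q _ => hRq n hn q
  obtain ⟨n, hn, hlt⟩ := hinf.exists_gt N₂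
  have : R (n + 1) < R n :=
    Finset.sum_lt_sum (fun q _ => hRq n (by omega) q)
      ⟨(e n).place, Finset.mem_univ _, (hkeep n (by omega)).2.2 ((PC.inPush_iff _).1 hn)⟩
  rw [hconst' n (by omega), hconst' (n + 1) (by omega)] at this
  exact this.false

end Progress

/-! ### Operations in an execution -/

/-- An operation of `p` is invoked at step `i` and has not responded before step `j`. -/
def Pending {Place Task : Type*} (e : ℕ → Event Place Task) (p : Place) (i j : ℕ) : Prop :=
  i < j ∧ (e i).IsInv ∧ (e i).place = p ∧
    ∀ l, i < l → l < j → (e l).place = p → ¬ (e l).IsRet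

section Pending

variable {Place Task : Type*} {e : ℕ → Event Place Task} {p : Place} {i j l m : ℕ}

theorem During.pending (h : During e i m) : Pending e (e m).place i m := by
  refine ⟨h.2.1, h.1, h.2.2.1.symm, fun l hl hlm hp => h.2.2.2 l hl hlm (hp.trans h.2.2.1)⟩

theorem Pending.during (h : Pending e p i m) (hm : (e m).place = p) : During e i m :=
  ⟨h.2.1, h.1, hm.trans h.2.2.1.symm, fun l hl hlm hp => h.2.2.2 l hl hlm (hp.trans h.2.2.1)⟩

theorem Pending.mono (h : Pending e p i j) (hl : i < l) (hlj : l ≤ j) : Pending e p i l :=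
  ⟨hl, h.2.1, h.2.2.1, fun l' h1 h2 => h.2.2.2 l' h1 (h2.trans_le hlj)⟩

theorem Pending.succ (h : Pending e p i j) (hj : (e j).place = p → ¬ (e j).IsRet) :
    Pending e p i (j + 1) :=
  ⟨h.1.trans j.lt_succ_self, h.2.1, h.2.2.1, fun l h1 h2 hp => by
    rcases (Nat.lt_succ_iff.1 h2).lt_or_eq with h3 | rfl
    · exact h.2.2.2 l h1 h3 hp
    · exact hj hp⟩

theorem Pending.start (hi : (e i).IsInv) : Pending e (e i).place i (i + 1) :=
  ⟨i.lt_succ_self, hi, rfl, fun l h1 h2 => by omega⟩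

end Pending

section Traces

variable {Place Task Prio : Type*} [DecidableEq Place] [LinearOrder Prio] {prio : Task → Prio}

section Step

variable {s s' : Config Place Task} {ev : Event Place Task} {G : List ℕ} {L : Place → List ℕ}

theorem Step.idle_iff (st : Step prio s ev s') : s.pc ev.place = .idle ↔ ev.IsInv := by
  cases st <;> simp_all [Event.place, Event.IsInv]

theorem Step.idle_iff_isRet (st : Step prio s ev s') : s'.pc ev.place = .idle ↔ ev.IsRet := by
  cases st with
  | pushCount p k r hpc hr =>
    by_cases h0 : r = 0 <;> simp [Event.place, Event.IsRet, Config.goto, h0]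
  | glTest_done p c hpc hv =>
    cases c <;> simp [Event.place, Event.IsRet, Config.goto, Caller.after]
  | _ => simp [Event.place, Event.IsRet, Config.goto]

theorem Inv.item_step (h : Inv s G L) (st : Step prio s ev s') {a : ℕ} {d : ItemData Place Task}
    (ha : s.item a = some d) : s'.item a = some d := by
  cases st with
  | pushNew p k t hpc =>
    have : a ≠ s.fresh := by
      rintro rfl
      simp [h.mem.fresh _ le_rfl] at ha
    simpa [Config.goto, Config.alloc, this] using ha
  | pushAdd p k b hpc =>
    simp only [Config.goto, Config.link]
    split <;> exact ha
  | _ => exact ha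

theorem Step.taken_iff (st : Step prio s ev s') (a : ℕ) :
    s'.taken a = true ↔ s.taken a = true ∨ ∃ q, ev = .take q a := by
  cases st with
  | pushAdd p k b hpc =>
    simp only [Config.goto, Config.link]
    split <;> simp
  | popTAS_success p b t hpc ht =>
    by_cases hab : a = b
    · subst hab
      simp [Config.goto]
    · simp [Config.goto, hab, Ne.symm hab]
  | _ => simp [Config.goto, Config.alloc, Config.addRef]

theorem Inv.stored_step (h : Inv s G L) (st : Step prio s ev s') (a : ℕ) :
    s'.Stored a ↔ s.Stored a ∨ ∃ p, ev = .insert p a := by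
  obtain ⟨G', L', h', hh⟩ := h.step st
  rw [h'.stored_iff, h.stored_iff, hh]

theorem Inv.of_insert (h : Inv s G L) {p : Place} {a : ℕ} (st : Step prio s (.insert p a) s') :
    (∃ k, s.pc p = .pushAdd k a) ∧ (s'.pc p).stage = 6 ∧ ¬ s.Stored a := by
  cases st with
  | pushAdd _ k _ hpc =>
    refine ⟨⟨k, hpc⟩, by simp [Config.goto, PC.stage], ?_⟩
    rw [h.stored_iff]
    exact (h.ctl hpc).2.1

theorem Step.of_publish {p : Place} (st : Step prio s (.publish p) s') :
    (s.pc p).stage = 4 ∧ (s'.pc p).stage = 3 := by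
  cases st with
  | pushCAS_success _ v hpc hv => simp [hpc, Config.goto, PC.stage]

theorem Inv.of_take (h : Inv s G L) {p : Place} {a : ℕ} (st : Step prio s (.take p a) s') :
    s.taken a = false ∧ s.Stored a ∧ ∃ d, s.item a = some d ∧ s.pc p = .popTAS a d.task ∧
      s'.pc p = .popRet (some d.task) := by
  cases st with
  | popTAS_success _ _ t hpc ht =>
    obtain ⟨-, hs, d, hd, rfl⟩ := h.ctl hpc
    exact ⟨ht, (h.stored_iff a).2 hs, d, hd, hpc, by simp [Config.goto]⟩

theorem Step.of_retPop {p : Place} {r : Option Task} (st : Step prio s (.retPop p r) s') :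
    s.pc p = .popRet r := by
  cases st with
  | popRet _ _ hpc => exact hpc

theorem Step.of_retPush {p : Place} (st : Step prio s (.retPush p) s') :
    s.pc p = .pushRet := by
  cases st with
  | pushRet _ hpc => exact hpc

theorem Step.of_pushNew (st : Step prio s ev s') {k : ℕ} {t : Task}
    (hpc : s.pc ev.place = .pushNew k t) :
    ∃ a, s'.pc ev.place = .pushAdd k a ∧ s'.item a = some ⟨ev.place, k, t⟩ ∧
      s'.remaining ev.place = s.remaining ev.place := by
  cases st <;> simp_all [Event.place, Config.goto, Config.alloc]

theorem Step.of_pushAdd (st : Step prio s ev s') {k a : ℕ}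
    (hpc : s.pc ev.place = .pushAdd k a) :
    ev = .insert ev.place a ∧ s'.pc ev.place = .pushRef k a ∧
      s'.remaining ev.place = s.remaining ev.place := by
  cases st with
  | pushAdd p k' a' hpc' =>
    cases hpc'.symm.trans hpc
    refine ⟨rfl, by simp [Event.place, Config.goto], ?_⟩
    simp only [Config.goto, Config.link]
    split <;> rfl
  | _ => simp_all [Event.place]

theorem Step.of_pushRef (st : Step prio s ev s') {k a : ℕ}
    (hpc : s.pc ev.place = .pushRef k a) :
    s'.pc ev.place = .pushCount k ∧ s'.remaining ev.place = s.remaining ev.place := by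
  cases st <;> simp_all [Event.place, Config.goto, Config.addRef]

theorem Step.of_pushCount (st : Step prio s ev s') {k : ℕ}
    (hpc : s.pc ev.place = .pushCount k) (hr : min (s.remaining ev.place - 1) (k : ℕ∞) ≠ 0) :
    s'.pc ev.place = .pushRet := by
  cases st with
  | pushCount p k' r hpc' hr' =>
    cases hpc'.symm.trans hpc
    have : r ≠ 0 := hr' ▸ hr
    simp [Event.place, Config.goto, this]
  | _ => simp_all [Event.place]

theorem Step.of_pushRet (st : Step prio s ev s') (hpc : s.pc ev.place = .pushRet) :
    ev.IsRet := by
  cases st <;> simp_all [Event.place, Event.IsRet]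

/-- Steps of a `pop` other than its response. -/
theorem Step.of_pop (st : Step prio s ev s') (h9 : (s.pc ev.place).stage = 9)
    (hidle : s.pc ev.place ≠ .idle) (hret : ¬ ev.IsRet) :
    (s'.pc ev.place).stage = 9 ∧ (∀ r, s.pc ev.place ≠ .popRet r) ∧
      ∀ t, s'.pc ev.place = .popRet (some t) → ∃ a, ev = .take ev.place a := by
  cases st with
  | glTest_done p c hpc hv =>
    cases c <;> simp_all [Event.place, Config.goto, PC.stage, Caller.after]
  | glTest_more p c v hpc hv hne => cases c <;> simp_all [Event.place, Config.goto, PC.stage]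
  | glItem_own p c a d hpc hn hd hp => cases c <;> simp_all [Event.place, Config.goto, PC.stage]
  | glItem_other p c a d hpc hn hd hp =>
    cases c <;> simp_all [Event.place, Config.goto, PC.stage]
  | glTaken_skip p c a hpc ht => cases c <;> simp_all [Event.place, Config.goto, PC.stage]
  | glTaken_add p c a hpc ht =>
    cases c <;> simp_all [Event.place, Config.goto, Config.addRef, PC.stage]
  | glNext p c a hpc hn => cases c <;> simp_all [Event.place, Config.goto, PC.stage]
  | _ => simp_all [Event.place, Event.IsRet, Config.goto, Config.addRef, PC.stage]

end Step

variable {s : ℕ → Config Place Task} {e : ℕ → Event Place Task} {n : ℕ}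

theorem IsExec.item_mono (hx : IsExec prio s e n) {j j' a : ℕ} {d : ItemData Place Task}
    (hjj : j ≤ j') (hj : j' ≤ n) (ha : (s j).item a = some d) : (s j').item a = some d := by
  induction j', hjj using Nat.le_induction with
  | base => exact ha
  | succ j' _ ih =>
    obtain ⟨G, L, hi⟩ := hx.inv (j := j') (by omega)
    exact hi.item_step (hx.2 j' (by omega)) (ih (by omega))

theorem IsExec.taken_iff (hx : IsExec prio s e n) {j : ℕ} (hj : j ≤ n) (a : ℕ) :
    (s j).taken a = true ↔ TakenBefore e a j := by
  induction j with
  | zero => simp [hx.1, init, TakenBefore]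
  | succ j ih =>
    rw [(hx.2 j (by omega)).taken_iff, ih (by omega)]
    simp only [TakenBefore, Nat.lt_succ_iff_lt_or_eq, or_and_right, exists_or, exists_eq_left]

theorem IsExec.stored_iff (hx : IsExec prio s e n) {j : ℕ} (hj : j ≤ n) (a : ℕ) :
    (s j).Stored a ↔ ∃ l < j, ∃ p, e l = .insert p a := by
  induction j with
  | zero => simp [hx.1, inv_init.stored_iff, Held]
  | succ j ih =>
    obtain ⟨G, L, hi⟩ := hx.inv (j := j) (by omega)
    rw [hi.stored_step (hx.2 j (by omega)), ih (by omega)]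
    simp only [Nat.lt_succ_iff_lt_or_eq, or_and_right, exists_or, exists_eq_left]

/-- A place with a pending operation is not idle. -/
theorem IsExec.not_idle (hx : IsExec prio s e n) {p : Place} {i j : ℕ} (hp : Pending e p i j)
    (hj : j ≤ n) : (s j).pc p ≠ .idle := by
  obtain ⟨hij, hinv, hpl, hret⟩ := hp
  induction j, hij using Nat.le_induction with
  | base =>
    rw [← hpl, Ne, (hx.2 i hj).idle_iff_isRet]
    cases h : e i <;> simp_all [Event.IsInv, Event.IsRet]
  | succ j hij ih =>
    by_cases hjp : (e j).place = p
    · subst hjp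
      rw [Ne, (hx.2 j hj).idle_iff_isRet]
      exact hret j hij (by omega) rfl
    · rw [((hx.2 j hj).other (Ne.symm hjp)).1]
      exact ih (by omega) fun l h1 h2 => hret l h1 (by omega)

theorem IsExec.pending_unique (hx : IsExec prio s e n) {p : Place} {i i' j : ℕ} (hj : j ≤ n)
    (h : Pending e p i j) (h' : Pending e p i' j) : i = i' := by
  have key : ∀ {i i' : ℕ}, Pending e p i j → Pending e p i' j → ¬ i < i' := by
    intro i i' h h' hlt
    refine hx.not_idle (h.mono hlt h'.1.le) (h'.1.le.trans hj) ?_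
    have := (hx.2 i' (by have := h'.1; omega)).idle_iff.2 h'.2.1
    rwa [h'.2.2.1] at this
  have h1 := key h h'
  have h2 := key h' h
  omega

theorem IsExec.exists_pending (hx : IsExec prio s e n) {p : Place} {j : ℕ} (hj : j ≤ n)
    (hp : (s j).pc p ≠ .idle) : ∃ i, Pending e p i j := by
  induction j with
  | zero => simp [hx.1, init] at hp
  | succ j ih =>
    have st := hx.2 j hj
    by_cases hjp : (e j).place = p
    · subst hjp
      by_cases hinv : (e j).IsInv
      · exact ⟨j, .start hinv⟩
      · obtain ⟨i, hi⟩ := ih (by omega) (mt st.idle_iff.1 hinv)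
        exact ⟨i, hi.succ fun _ => mt st.idle_iff_isRet.2 hp⟩
    · rw [(st.other (Ne.symm hjp)).1] at hp
      obtain ⟨i, hi⟩ := ih (by omega) hp
      exact ⟨i, hi.succ fun h => absurd h hjp⟩

theorem IsExec.exists_during (hx : IsExec prio s e n) {m : ℕ} (hm : m < n)
    (hinv : ¬ (e m).IsInv) : ∃ i, During e i m := by
  obtain ⟨i, hi⟩ := hx.exists_pending hm.le (mt (hx.2 m hm).idle_iff.1 hinv)
  exact ⟨i, hi.during rfl⟩

theorem IsExec.during_unique (hx : IsExec prio s e n) {i i' m : ℕ} (hm : m < n)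
    (h : During e i m) (h' : During e i' m) : i = i' :=
  hx.pending_unique hm.le h.pending h'.pending

/-- During an operation the stage never increases. -/
theorem IsExec.stage_mono (hx : IsExec prio s e n) {p : Place} {i l j : ℕ}
    (hp : Pending e p i j) (hil : i < l) (hlj : l ≤ j) (hj : j ≤ n) :
    ((s j).pc p).stage ≤ ((s l).pc p).stage := by
  induction j, hlj using Nat.le_induction with
  | base => exact le_rfl
  | succ j hlj ih =>
    refine le_trans ?_ (ih (hp.mono (by omega) (by omega)) (by omega))
    have st := hx.2 j hj
    by_cases hjp : (e j).place = p
    · obtain ⟨G, L, hi⟩ := hx.inv (j := j) (by omega)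
      have hret := hp.2.2.2 j (by omega) (by omega) hjp
      subst hjp
      rcases hi.step_stage st (fun q hq => hret (by simp [hq, Event.IsRet])) with h | h
      · exact h.le
      · exact h.1.le
    · rw [(st.other (Ne.symm hjp)).1]

/-- A `push` allocates its item, inserts it into the local list, and goes on. -/
theorem IsExec.push_trace (hx : IsExec prio s e n) {p : Place} {k : ℕ} {t : Task} {i j : ℕ}
    (hi : e i = .invPush p k t) (hp : Pending e p i j) (hj : j ≤ n) :
    (s j).pc p = .pushNew k t ∨
    (∃ a, (s j).pc p = .pushAdd k a ∧ (s j).item a = some ⟨p, k, t⟩) ∨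
    (((s j).pc p).stage ≤ 6 ∧ ∃ l a, i < l ∧ l < j ∧ e l = .insert p a) := by
  have hij : i + 1 ≤ j := hp.1
  induction j, hij using Nat.le_induction with
  | base =>
    left
    have st := hx.2 i hj
    rw [hi] at st
    generalize s (i + 1) = s' at st
    cases st
    simp [Config.goto]
  | succ j hij ih =>
    have st := hx.2 j hj
    have ih := ih (hp.mono (by omega) (by omega)) (by omega)
    by_cases hjp : (e j).place = p
    · subst hjp
      rcases ih with h | ⟨a, h, ha⟩ | ⟨h, l, a, h1, h2, h3⟩
      · obtain ⟨a, h1, h2, -⟩ := st.of_pushNew h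
        exact .inr (.inl ⟨a, h1, h2⟩)
      · obtain ⟨h1, h2, -⟩ := st.of_pushAdd h
        exact .inr (.inr ⟨by simp [h2, PC.stage], j, a, by omega, by omega, h1⟩)
      · refine .inr (.inr ⟨le_trans ?_ h, l, a, h1, by omega, h3⟩)
        exact hx.stage_mono hp (by omega) (Nat.le_succ j) hj
    · rw [(st.other (Ne.symm hjp)).1]
      rcases ih with h | ⟨a, h, ha⟩ | ⟨h, l, a, h1, h2, h3⟩
      · exact .inl h
      · exact .inr (.inl ⟨a, h, hx.item_mono (Nat.le_succ j) hj ha⟩)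
      · exact .inr (.inr ⟨h, l, a, h1, by omega, h3⟩)

theorem IsExec.push_stage (hx : IsExec prio s e n) {p : Place} {k : ℕ} {t : Task} {i j : ℕ}
    (hi : e i = .invPush p k t) (hp : Pending e p i j) (hj : j ≤ n) :
    ((s j).pc p).stage ≠ 9 := by
  rcases hx.push_trace hi hp hj with h | ⟨a, h, -⟩ | ⟨h, -⟩
  · simp [h, PC.stage]
  · simp [h, PC.stage]
  · omega

/-- A `pop` stays outside `push`, and it has taken an item if and only if it is about to return
its task. -/
theorem IsExec.pop_trace (hx : IsExec prio s e n) {p : Place} {i j : ℕ}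
    (hi : e i = .invPop p) (hp : Pending e p i j) (hj : j ≤ n) :
    ((s j).pc p).stage = 9 ∧
    (∀ t, (s j).pc p = .popRet (some t) → ∃ l a, i < l ∧ l < j ∧ e l = .take p a) ∧
    (∀ l a, i < l → l < j → e l = .take p a →
      ∃ d, (s j).item a = some d ∧ (s j).pc p = .popRet (some d.task)) := by
  have hij : i + 1 ≤ j := hp.1
  induction j, hij using Nat.le_induction with
  | base =>
    have st := hx.2 i hj
    rw [hi] at st
    generalize s (i + 1) = s' at st
    cases st
    simp only [Config.goto, Function.update_self, PC.stage]
    exact ⟨trivial, by simp, fun l a h1 h2 => by omega⟩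
  | succ j hij ih =>
    have st := hx.2 j hj
    have hp' := hp.mono (l := j) (by omega) (by omega)
    obtain ⟨ih1, ih2, ih3⟩ := ih hp' (by omega)
    by_cases hjp : (e j).place = p
    · subst hjp
      obtain ⟨h1, h2, h3⟩ := st.of_pop ih1 (hx.not_idle hp' (by omega))
        (hp.2.2.2 j (by omega) (by omega) rfl)
      refine ⟨h1, fun t ht => ?_, fun l a hl hlj hla => ?_⟩
      · obtain ⟨a, ha⟩ := h3 t ht
        exact ⟨j, a, by omega, by omega, ha⟩
      · rcases (Nat.lt_succ_iff.1 hlj).lt_or_eq with hlt | rfl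
        · obtain ⟨d, -, hd⟩ := ih3 l a hl hlt hla
          exact absurd hd (h2 _)
        · obtain ⟨G, L, hi'⟩ := hx.inv (j := l) (by omega)
          rw [hla] at st
          obtain ⟨-, -, d, hd, -, hpc⟩ := hi'.of_take st
          rw [hla]
          exact ⟨d, hx.item_mono (Nat.le_succ l) hj hd, hpc⟩
    · rw [(st.other (Ne.symm hjp)).1]
      refine ⟨ih1, fun t ht => ?_, fun l a hl hlj hla => ?_⟩
      · obtain ⟨l, a, h1, h2, h3⟩ := ih2 t ht
        exact ⟨l, a, h1, by omega, h3⟩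
      · rcases (Nat.lt_succ_iff.1 hlj).lt_or_eq with hlt | rfl
        · obtain ⟨d, hd, hpc⟩ := ih3 l a hl hlt hla
          exact ⟨d, hx.item_mono (Nat.le_succ j) hj hd, hpc⟩
        · exact absurd (by rw [hla]; rfl) hjp

end Traces

/-! ### Room in the local list -/

section Room

variable {Place Task : Type*} {s : Config Place Task} {G : List ℕ} {L : Place → List ℕ} {p : Place}

theorem Inv.isLocalList (h : Inv s G L) (hp : s.pc p ≠ .pushNewList) : s.IsLocalList p (L p) :=
  (s.listFrom_iff _ _).2 ((h.place p).list hp).1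

theorem Inv.budgetOk (h : Inv s G L) (hp : (s.pc p).stage = 9) : s.BudgetOk L p := by
  have hc := (h.place p).ctl
  generalize s.pc p = c at hc hp
  cases c with
  | idle => exact hc
  | glTest c => cases c with
    | inPush => simp [PC.stage] at hp
    | inPop => exact hc
  | glItem c => cases c with
    | inPush => simp [PC.stage] at hp
    | inPop => exact hc.1
  | glTaken c a => cases c with
    | inPush => simp [PC.stage] at hp
    | inPop => exact hc.1
  | glNext c => cases c with
    | inPush => simp [PC.stage] at hp
    | inPop => exact hc.1
  | _ => first
    | exact hc
    | exact hc.1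
    | simp [PC.stage] at hp

/-- The budget of a local list exceeds `m` if and only if `m` further tasks can be pushed without
any task being followed by as many tasks as its parameter. -/
theorem MemOk.lt_budget_iff (h : MemOk s G L) {m : ℕ} :
    (m : ℕ∞) < budget ((L p).map s.kOf) ↔
      ∀ (L₁ : List ℕ) (a : ℕ) (L₂ : List ℕ), L p = L₁ ++ a :: L₂ →
        ∀ d, s.item a = some d → L₂.length + m < d.k := by
  rw [HybridK.lt_budget_iff]
  constructor
  · intro H L₁ a L₂ he d hd
    have := H (L₁.map s.kOf) (s.kOf a) (L₂.map s.kOf) (by simp [he])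
    simpa [Config.kOf, hd] using this
  · intro H l₁ k l₂ he
    obtain ⟨L₁, M, hM, rfl, hM'⟩ := List.map_eq_append_iff.1 he
    obtain ⟨a, L₂, rfl, rfl, rfl⟩ := List.map_eq_cons_iff.1 hM'
    obtain ⟨d, hd, -⟩ := h.own p a (by simp [hM])
    simpa [Config.kOf, hd] using H L₁ a L₂ hM d hd

end Room

section WaitFree

variable {Place Task Prio : Type*} [DecidableEq Place] [LinearOrder Prio] {prio : Task → Prio}
  {s : ℕ → Config Place Task} {e : ℕ → Event Place Task} {n : ℕ}

theorem localListsRelaxed (prio : Task → Prio) : LocalListsRelaxed Place prio := by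
  intro s e n hx p hp
  obtain ⟨G, L, hi⟩ := hx.inv le_rfl
  have h9 : ((s n).pc p).stage = 9 := not_not.1 (mt (PC.inPush_iff _).2 hp)
  have hB := hi.budgetOk h9
  refine ⟨L p, hi.isLocalList fun h => by simp [h, PC.stage] at h9, fun L₁ a L₂ he => ?_⟩
  obtain ⟨d, hd, hdp⟩ := hi.mem.own p a (by simp [he])
  exact ⟨d, hd, hdp, (hi.mem.lt_budget_iff (m := 0)).1 hB.2 L₁ a L₂ he d hd⟩

/-- A `push` whose place has room for the task never enters the loop. -/
theorem IsExec.room_trace (hx : IsExec prio s e n) {p : Place} {k : ℕ} {t : Task} {i j : ℕ}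
    (hi : e i = .invPush p k t) (hk : 0 < k) (hr : 1 < (s i).remaining p)
    (hp : Pending e p i j) (hj : j ≤ n) :
    (((s j).pc p = .pushNew k t ∨ (∃ a, (s j).pc p = .pushAdd k a) ∨
        (∃ a, (s j).pc p = .pushRef k a) ∨ (s j).pc p = .pushCount k) ∧
      (s j).remaining p = (s i).remaining p) ∨ (s j).pc p = .pushRet := by
  have hij : i + 1 ≤ j := hp.1
  induction j, hij using Nat.le_induction with
  | base =>
    left
    have st := hx.2 i hj
    rw [hi] at st
    generalize s (i + 1) = s' at st
    cases st
    simp [Config.goto]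
  | succ j hij ih =>
    have st := hx.2 j hj
    have ih := ih (hp.mono (by omega) (by omega)) (by omega)
    by_cases hjp : (e j).place = p
    · subst hjp
      rcases ih with ⟨h | ⟨a, h⟩ | ⟨a, h⟩ | h, hrem⟩ | h
      · obtain ⟨a, h1, -, h2⟩ := st.of_pushNew h
        exact .inl ⟨.inr (.inl ⟨a, h1⟩), h2.trans hrem⟩
      · obtain ⟨-, h1, h2⟩ := st.of_pushAdd h
        exact .inl ⟨.inr (.inr (.inl ⟨a, h1⟩)), h2.trans hrem⟩
      · obtain ⟨h1, h2⟩ := st.of_pushRef h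
        exact .inl ⟨.inr (.inr (.inr h1)), h2.trans hrem⟩
      · refine .inr (st.of_pushCount h (pos_iff_ne_zero.1 ?_))
        rw [hrem]
        exact lt_min (tsub_pos_of_lt hr) (by exact_mod_cast hk)
      · exact absurd (st.of_pushRet h) (hp.2.2.2 j (by omega) (by omega) rfl)
    · rw [(st.other (Ne.symm hjp)).1, (st.other (Ne.symm hjp)).2.2]
      exact ih

theorem pushWaitFreeWithRoom (prio : Task → Prio) : PushWaitFreeWithRoom Place prio := by
  refine ⟨9, fun s e n hx i p k t L₀ hin hi hL₀ hroom => ?_⟩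
  obtain ⟨G, L, hinv⟩ := hx.inv hin.le
  have hidle : (s i).pc p = .idle := by
    have := (hx.2 i hin).idle_iff.2 (by rw [hi]; trivial)
    rwa [hi] at this
  have h9 : ((s i).pc p).stage = 9 := by rw [hidle]; rfl
  obtain rfl : L₀ = L p := ((s i).listFrom_iff _ _).1 hL₀ |>.unique
    ((hinv.place p).list (by simp [hidle])).1
  have hr : 1 < (s i).remaining p := by
    rw [(hinv.budgetOk h9).1]
    exact_mod_cast (hinv.mem.lt_budget_iff (m := 1)).2 hroom.2
  have hpl : ∀ m, During e i m → (e m).place = p := fun m hm => by rw [hm.2.2.1, hi]; rfl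
  have hpend : ∀ m, During e i m → Pending e p i m := fun m hm => hpl m hm ▸ hm.pending
  -- Outside the loop every step decreases the stage, which numbers the steps.
  have hdec : ∀ m m', m' < n → During e i m → During e i m' → m < m' →
      ((s m').pc p).stage < ((s m).pc p).stage := by
    intro m m' hm' hd hd' hlt
    refine (hx.stage_mono (hpend m' hd') (hd.2.1.trans m.lt_succ_self) hlt hm'.le).trans_lt ?_
    obtain ⟨G, L, him⟩ := hx.inv (j := m) (by omega)
    have hnret : ¬ (e m).IsRet := hd'.2.2.2 m hd.2.1 hlt hd.2.2.1
    have htr := hx.room_trace hi hroom.1 hr (hpend m hd) (by omega)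
    rw [← hpl m hd] at htr ⊢
    rcases him.step_stage (hx.2 m (by omega)) (fun q hq => hnret (by simp [hq, Event.IsRet]))
      with h | ⟨-, -, h⟩
    · exact h
    · exfalso
      rcases htr with ⟨h' | ⟨a, h'⟩ | ⟨a, h'⟩ | h', -⟩ | h' <;>
        simp [h', PC.stage, loopRank] at h
  have hcard : (Set.Iio 9 : Set ℕ).ncard = 9 := by simp
  rw [← hcard]
  refine Set.ncard_le_ncard_of_injOn (fun m => ((s m).pc p).stage) ?_ ?_ (Set.finite_Iio 9)
  · rintro m ⟨hm, hd⟩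
    rcases hx.room_trace hi hroom.1 hr (hpend m hd) hm.le with
      ⟨h' | ⟨a, h'⟩ | ⟨a, h'⟩ | h', -⟩ | h' <;> simp [h', PC.stage]
  · rintro m ⟨hm, hd⟩ m' ⟨hm', hd'⟩ heq
    change ((s m).pc p).stage = ((s m').pc p).stage at heq
    rcases lt_trichotomy m m' with h | h | h
    · have := hdec m m' hm' hd hd' h
      omega
    · exact h
    · have := hdec m' m hm hd' hd h
      omega

end WaitFree

/-! ### Linearization points -/

section Points

variable {Place Task Prio : Type*}

/-- Step `m` is the linearization point of the `push` invoked at step `i`, whose item is `a`. -/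
def IsItemPoint (e : ℕ → Event Place Task) (n i a m : ℕ) : Prop :=
  ∃ (p : Place) (l : ℕ), l < n ∧ During e i l ∧ e l = .insert p a ∧
    ((m < n ∧ During e i m ∧ e m = .publish p ∧ ¬ TakenBefore e a m) ∨
      (m = l ∧ ∀ c, c < n → During e i c → e c = .publish p → TakenBefore e a c))

theorem isPushPoint_iff {e : ℕ → Event Place Task} {n i m : ℕ} :
    IsPushPoint e n i m ↔ ∃ a, IsItemPoint e n i a m :=
  ⟨fun ⟨p, a, l, h⟩ => ⟨a, p, l, h⟩, fun ⟨a, p, l, h⟩ => ⟨p, a, l, h⟩⟩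

theorem takenBefore_succ {e : ℕ → Event Place Task} {a m : ℕ} :
    TakenBefore e a (m + 1) ↔ TakenBefore e a m ∨ ∃ q, e m = .take q a := by
  simp only [TakenBefore, Nat.lt_succ_iff_lt_or_eq, or_and_right, exists_or, exists_eq_left]

/-- The task of item `a` is available before step `m`: its `push` has taken effect, and it has not
been taken. -/
def Live (e : ℕ → Event Place Task) (n m a : ℕ) : Prop :=
  (∃ i j, IsItemPoint e n i a j ∧ j < m) ∧ ¬ TakenBefore e a m

/-- The tasks of a set of items. -/
def tasksOf (item : ℕ → Option (ItemData Place Task)) (T : Finset ℕ) : Multiset Task :=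
  T.val.filterMap fun a => (item a).map ItemData.task

theorem tasksOf_insert {item : ℕ → Option (ItemData Place Task)} {T : Finset ℕ} {a : ℕ}
    {d : ItemData Place Task} (ha : a ∉ T) (hd : item a = some d) :
    tasksOf item (insert a T) = d.task ::ₘ tasksOf item T := by
  rw [tasksOf, Finset.insert_val_of_notMem ha,
    Multiset.filterMap_cons_some _ _ _ (b := d.task) (by simp [hd])]
  rfl

variable {s : ℕ → Config Place Task} {e : ℕ → Event Place Task} {n : ℕ}

/-- An operation responds at most once. -/
theorem During.ret_unique {i l l' : ℕ} (hd : During e i l) (hd' : During e i l')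
    (h : (e l).IsRet) (h' : (e l').IsRet) : l = l' := by
  have h1 : ¬ l < l' := fun hlt => hd'.2.2.2 l hd.2.1 hlt hd.2.2.1 h
  have h2 : ¬ l' < l := fun hlt => hd.2.2.2 l' hd'.2.1 hlt hd'.2.2.1 h'
  omega

theorem IsItemPoint.lt_and_during {i a m : ℕ} (h : IsItemPoint e n i a m) :
    m < n ∧ During e i m := by
  obtain ⟨p, l, hl, hd, -, ⟨hm, hdm, -⟩ | ⟨rfl, -⟩⟩ := h
  · exact ⟨hm, hdm⟩
  · exact ⟨hl, hd⟩

theorem IsItemPoint.ne_take {i a m b : ℕ} {q : Place} (h : IsItemPoint e n i a m) :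
    e m ≠ .take q b := by
  obtain ⟨p, l, hl, hd, he, ⟨hm, hdm, he', -⟩ | ⟨rfl, -⟩⟩ := h <;> simp [*]

theorem IsItemPoint.ne_retPop {i a m : ℕ} {q : Place} {r : Option Task}
    (h : IsItemPoint e n i a m) : e m ≠ .retPop q r := by
  obtain ⟨p, l, hl, hd, he, ⟨hm, hdm, he', -⟩ | ⟨rfl, -⟩⟩ := h <;> simp [*]

/-- Step `m` is the linearization point of the operation invoked at step `i`: the one prescribed for
a `push`, the step that takes an item for a successful `pop`, and the response of a `pop` that
returns null. -/
def IsPoint (e : ℕ → Event Place Task) (n i m : ℕ) : Prop :=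
  IsPushPoint e n i m ∨ m < n ∧ During e i m ∧
    ((∃ q a, e m = .take q a) ∨ ∃ q, e m = .retPop q none)

theorem IsPoint.lt_and_during {i m : ℕ} (h : IsPoint e n i m) : m < n ∧ During e i m := by
  rcases h with h | ⟨h1, h2, -⟩
  · obtain ⟨a, ha⟩ := isPushPoint_iff.1 h
    exact ha.lt_and_during
  · exact ⟨h1, h2⟩

open Classical in
/-- The items that are available before step `m`. -/
noncomputable def liveItems (s : ℕ → Config Place Task) (e : ℕ → Event Place Task) (n m : ℕ) :
    Finset ℕ := (Finset.range (s n).fresh).filter (Live e n m)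

theorem liveItems_congr {m m' : ℕ} (h : ∀ b, Live e n m' b ↔ Live e n m b) :
    liveItems s e n m' = liveItems s e n m := by
  ext b
  simp [liveItems, h]

/-- Steps that are neither linearization points of a `push` nor take an item change nothing. -/
theorem live_frame {m : ℕ} (hp : ∀ i a, ¬ IsItemPoint e n i a m) (ht : ∀ q a, e m ≠ .take q a)
    (b : ℕ) : Live e n (m + 1) b ↔ Live e n m b := by
  have htb : TakenBefore e b (m + 1) ↔ TakenBefore e b m := by
    simp [takenBefore_succ, ht]
  simp only [Live, htb]
  refine and_congr_left fun _ => ⟨?_, ?_⟩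
  · rintro ⟨i, j, h, hj⟩
    rcases (Nat.lt_succ_iff.1 hj).lt_or_eq with hlt | rfl
    · exact ⟨i, j, h, hlt⟩
    · exact absurd h (hp i b)
  · rintro ⟨i, j, h, hj⟩
    exact ⟨i, j, h, by omega⟩

variable [DecidableEq Place] [LinearOrder Prio] {prio : Task → Prio}

/-- The stage of the place of a step tells whether the step belongs to a `push` or to a `pop`. -/
theorem IsExec.push_or_pop (hx : IsExec prio s e n) {i m : ℕ} (hm : m < n) (h : During e i m) :
    (∃ p k t, e i = .invPush p k t ∧ (e m).place = p ∧ ((s m).pc p).stage ≠ 9) ∨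
    (∃ p, e i = .invPop p ∧ (e m).place = p ∧ ((s m).pc p).stage = 9) := by
  have hp := h.pending
  have hpl := h.2.2.1
  rcases hi : e i with ⟨p, k, t⟩ | p | _ | _ | _ | _ | _ | _
  case invPush =>
    rw [hi] at hpl
    change (e m).place = p at hpl
    rw [hpl] at hp
    exact .inl ⟨p, k, t, rfl, hpl, hx.push_stage hi hp hm.le⟩
  case invPop =>
    rw [hi] at hpl
    change (e m).place = p at hpl
    rw [hpl] at hp
    exact .inr ⟨p, rfl, hpl, (hx.pop_trace hi hp hm.le).1⟩
  all_goals
    have := h.1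
    rw [hi] at this
    exact this.elim

/-- The operation that inserts item `a` is the `push` with the data of `a`. -/
theorem IsExec.of_insert (hx : IsExec prio s e n) {i l a : ℕ} {p : Place} (hl : l < n)
    (h : During e i l) (he : e l = .insert p a) :
    ∃ k t, e i = .invPush p k t ∧ (s l).item a = some ⟨p, k, t⟩ := by
  obtain ⟨G, L, hinv⟩ := hx.inv hl.le
  have st := hx.2 l hl
  rw [he] at st
  obtain ⟨⟨k', hpc⟩, -, -⟩ := hinv.of_insert st
  rcases hx.push_or_pop hl h with ⟨q, k, t, hi, hq, -⟩ | ⟨q, hi, hq, h9⟩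
  · rw [he] at hq
    change p = q at hq
    subst hq
    have hp := h.pending
    rw [he] at hp
    change Pending e p i l at hp
    rcases hx.push_trace hi hp hl.le with h' | ⟨b, h', hb⟩ | ⟨h', -⟩
    · simp [hpc] at h'
    · cases hpc.symm.trans h'
      exact ⟨_, t, hi, hb⟩
    · simp [hpc, PC.stage] at h'
  · rw [he] at hq
    change p = q at hq
    subst hq
    simp [hpc, PC.stage] at h9

/-- An operation that takes an item, or responds with the value of a `pop`, is a `pop`. -/
theorem IsExec.take_pop (hx : IsExec prio s e n) {i m a : ℕ} {q : Place} (hm : m < n)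
    (h : During e i m) (he : e m = .take q a) : e i = .invPop q := by
  obtain ⟨G, L, hinv⟩ := hx.inv hm.le
  have st := hx.2 m hm
  rw [he] at st
  obtain ⟨-, -, d, -, hpc, -⟩ := hinv.of_take st
  rcases hx.push_or_pop hm h with ⟨p, k, t, -, hp, h9⟩ | ⟨p, hi, hp, -⟩
  · rw [he] at hp
    change q = p at hp
    subst hp
    simp [hpc, PC.stage] at h9
  · rw [he] at hp
    rw [hi, ← hp]
    rfl

theorem IsExec.retPop_pop (hx : IsExec prio s e n) {i m : ℕ} {q : Place} {r : Option Task}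
    (hm : m < n) (h : During e i m) (he : e m = .retPop q r) : e i = .invPop q := by
  have st := hx.2 m hm
  rw [he] at st
  rcases hx.push_or_pop hm h with ⟨p, k, t, -, hp, h9⟩ | ⟨p, hi, hp, -⟩
  · rw [he] at hp
    change q = p at hp
    subst hp
    simp [st.of_retPop, PC.stage] at h9
  · rw [he] at hp
    rw [hi, ← hp]
    rfl

/-- An item is inserted at most once. -/
theorem IsExec.insert_unique (hx : IsExec prio s e n) {l l' a : ℕ} {p p' : Place} (hl : l < n)
    (hl' : l' < n) (h : e l = .insert p a) (h' : e l' = .insert p' a) : l = l' := by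
  have key : ∀ {l l' : ℕ} {p p' : Place}, l' < n → e l = .insert p a → e l' = .insert p' a →
      ¬ l < l' := by
    intro l l' p p' hl' h h' hlt
    obtain ⟨G, L, hinv⟩ := hx.inv hl'.le
    have st := hx.2 l' hl'
    rw [h'] at st
    exact (hinv.of_insert st).2.2 ((hx.stored_iff hl'.le a).2 ⟨l, hlt, p, h⟩)
  have h1 := key hl' h h'
  have h2 := key hl h' h
  omega

/-- An operation inserts at most one item. -/
theorem IsExec.insert_during_unique (hx : IsExec prio s e n) {i l l' a a' : ℕ} {p p' : Place}
    (hl : l < n) (hl' : l' < n) (hd : During e i l) (hd' : During e i l')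
    (h : e l = .insert p a) (h' : e l' = .insert p' a') : l = l' := by
  have key : ∀ {l l' a a' : ℕ} {p p' : Place}, l' < n → During e i l → During e i l' →
      e l = .insert p a → e l' = .insert p' a' → ¬ l < l' := by
    intro l l' a a' p p' hl' hd hd' h h' hlt
    have hpp : p' = p := by
      have := hd'.2.2.1.trans hd.2.2.1.symm
      rwa [h, h'] at this
    subst hpp
    have hp := hd'.pending
    rw [h'] at hp
    have hmono := hx.stage_mono (p := p') hp (hd.2.1.trans l.lt_succ_self) hlt hl'.le
    obtain ⟨G, L, hinv⟩ := hx.inv (j := l) (by omega)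
    obtain ⟨G', L', hinv'⟩ := hx.inv hl'.le
    have st := hx.2 l (by omega)
    have st' := hx.2 l' hl'
    rw [h] at st
    rw [h'] at st'
    obtain ⟨⟨k, hpc⟩, -⟩ := hinv'.of_insert st'
    rw [hpc, (hinv.of_insert st).2.1] at hmono
    simp [PC.stage] at hmono
  have h1 := key hl' hd hd' h h'
  have h2 := key hl hd' hd h' h
  omega

/-- An operation publishes at most once. -/
theorem IsExec.publish_unique (hx : IsExec prio s e n) {i l l' : ℕ} {p : Place}
    (hl : l < n) (hl' : l' < n) (hd : During e i l) (hd' : During e i l')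
    (h : e l = .publish p) (h' : e l' = .publish p) : l = l' := by
  have key : ∀ {l l' : ℕ}, l' < n → During e i l → During e i l' →
      e l = .publish p → e l' = .publish p → ¬ l < l' := by
    intro l l' hl' hd hd' h h' hlt
    have hp := hd'.pending
    rw [h'] at hp
    have hmono := hx.stage_mono (p := p) hp (hd.2.1.trans l.lt_succ_self) hlt hl'.le
    have st := hx.2 l (by omega)
    have st' := hx.2 l' hl'
    rw [h] at st
    rw [h'] at st'
    rw [st'.of_publish.1, st.of_publish.2] at hmono
    omega
  have h1 := key hl' hd hd' h h'
  have h2 := key hl hd' hd h' h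
  omega

/-- An operation takes at most one item. -/
theorem IsExec.take_unique (hx : IsExec prio s e n) {i l l' a a' : ℕ} {p p' : Place}
    (hl : l < n) (hl' : l' < n) (hd : During e i l) (hd' : During e i l')
    (h : e l = .take p a) (h' : e l' = .take p' a') : l = l' := by
  have key : ∀ {l l' a a' : ℕ} {p p' : Place}, l' < n → During e i l → During e i l' →
      e l = .take p a → e l' = .take p' a' → ¬ l < l' := by
    intro l l' a a' p p' hl' hd hd' h h' hlt
    have hpp : p' = p := by
      have := hd'.2.2.1.trans hd.2.2.1.symm
      rwa [h, h'] at this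
    subst hpp
    have hp := hd'.pending
    rw [h'] at hp
    obtain ⟨d, -, hpc⟩ := (hx.pop_trace (hx.take_pop hl' hd' h') hp hl'.le).2.2 l a hd.2.1 hlt h
    obtain ⟨G', L', hinv'⟩ := hx.inv hl'.le
    have st' := hx.2 l' hl'
    rw [h'] at st'
    obtain ⟨-, -, d', -, hpc', -⟩ := hinv'.of_take st'
    simp [hpc] at hpc'
  have h1 := key hl' hd hd' h h'
  have h2 := key hl hd' hd h' h
  omega

/-- A `pop` that returns a task has taken it. -/
theorem IsExec.take_of_ret (hx : IsExec prio s e n) {i j : ℕ} {q : Place} {t : Task}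
    (hj : j < n) (hd : During e i j) (he : e j = .retPop q (some t)) :
    ∃ m a d, m < n ∧ During e i m ∧ e m = .take q a ∧ (s n).item a = some d ∧ d.task = t := by
  have hi := hx.retPop_pop hj hd he
  have hp := hd.pending
  rw [he] at hp
  have st := hx.2 j hj
  rw [he] at st
  obtain ⟨-, h2, h3⟩ := hx.pop_trace hi hp hj.le
  obtain ⟨l, a, h4, h5, h6⟩ := h2 t st.of_retPop
  obtain ⟨d, hd', hpc⟩ := h3 l a h4 h5 h6
  refine ⟨l, a, d, by omega, (hp.mono h4 h5.le).during (by rw [h6]; rfl), h6,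
    hx.item_mono hj.le le_rfl hd', ?_⟩
  have := hpc.symm.trans st.of_retPop
  simpa using this

/-- A `pop` that returns null takes nothing. -/
theorem IsExec.not_take_of_ret (hx : IsExec prio s e n) {i j m a : ℕ} {q q' : Place}
    (hj : j < n) (hd : During e i j) (he : e j = .retPop q none) (hdm : During e i m) :
    e m ≠ .take q' a := by
  intro hm
  rcases lt_trichotomy m j with h | rfl | h
  · have hi := hx.retPop_pop hj hd he
    have hp := hd.pending
    have hqq : q' = q := by
      have := hdm.2.2.1.trans hd.2.2.1.symm
      rwa [he, hm] at this
    subst hqq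
    rw [he] at hp
    have st := hx.2 j hj
    rw [he] at st
    obtain ⟨d, -, hpc⟩ := (hx.pop_trace hi hp hj.le).2.2 m a hdm.2.1 h hm
    simp [st.of_retPop] at hpc
  · simp [he] at hm
  · exact hdm.2.2.2 j hd.2.1 h hd.2.2.1 (by simp [he, Event.IsRet])

end Points

section Linearization

variable {Place Task Prio : Type*} [DecidableEq Place] [LinearOrder Prio] {prio : Task → Prio}
  {s : ℕ → Config Place Task} {e : ℕ → Event Place Task} {n : ℕ}

theorem IsExec.itemPoint_push (hx : IsExec prio s e n) {i a m : ℕ} (h : IsItemPoint e n i a m) :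
    ∃ p k t, e i = .invPush p k t ∧ (s n).item a = some ⟨p, k, t⟩ := by
  obtain ⟨p, l, hl, hd, he, -⟩ := h
  obtain ⟨k, t, hi, ha⟩ := hx.of_insert hl hd he
  exact ⟨p, k, t, hi, hx.item_mono hl.le le_rfl ha⟩

/-- An item is not taken before it is inserted. -/
theorem IsExec.insert_lt_take (hx : IsExec prio s e n) {a l m : ℕ} {p q : Place} (hl : l < n)
    (hm : m < n) (he : e l = .insert p a) (ht : e m = .take q a) : l < m := by
  obtain ⟨G, L, hinv⟩ := hx.inv hm.le
  have st := hx.2 m hm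
  rw [ht] at st
  obtain ⟨l', hl', p', he'⟩ := (hx.stored_iff hm.le a).1 (hinv.of_take st).2.1
  rwa [hx.insert_unique hl (hl'.trans hm) he he']

theorem IsExec.itemPoint_not_taken (hx : IsExec prio s e n) {i a m : ℕ}
    (h : IsItemPoint e n i a m) : ¬ TakenBefore e a m := by
  obtain ⟨p, l, hl, hd, he, ⟨hm, hdm, he', hn⟩ | ⟨rfl, -⟩⟩ := h
  · exact hn
  · rintro ⟨j, hj, q, ht⟩
    have := hx.insert_lt_take hl (hj.trans hl) he ht
    omega

theorem IsExec.itemPoint_unique (hx : IsExec prio s e n) {i i' a m m' : ℕ}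
    (h : IsItemPoint e n i a m) (h' : IsItemPoint e n i' a m') : i = i' ∧ m = m' := by
  obtain ⟨p, l, hl, hd, he, h⟩ := h
  obtain ⟨p', l', hl', hd', he', h'⟩ := h'
  obtain rfl := hx.insert_unique hl hl' he he'
  obtain rfl := hx.during_unique hl hd hd'
  cases he.symm.trans he'
  refine ⟨rfl, ?_⟩
  rcases h with ⟨h1, h2, h3, h4⟩ | ⟨rfl, h1⟩ <;> rcases h' with ⟨h1', h2', h3', h4'⟩ | ⟨rfl, h1'⟩
  · exact hx.publish_unique h1 h1' h2 h2' h3 h3'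
  · exact absurd (h1' m h1 h2 h3) h4
  · exact absurd (h1 m' h1' h2' h3') h4'
  · rfl

theorem IsExec.itemPoint_item_unique (hx : IsExec prio s e n) {i a a' m m' : ℕ}
    (h : IsItemPoint e n i a m) (h' : IsItemPoint e n i a' m') : a = a' := by
  obtain ⟨p, l, hl, hd, he, h⟩ := h
  obtain ⟨p', l', hl', hd', he', h'⟩ := h'
  obtain rfl := hx.insert_during_unique hl hl' hd hd' he he'
  cases he.symm.trans he'
  rfl

/-- The `push` of each inserted item takes effect, and not later than the item is taken. -/
theorem IsExec.exists_itemPoint (hx : IsExec prio s e n) {l a : ℕ} {p : Place} (hl : l < n)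
    (he : e l = .insert p a) : ∃ i m, During e i l ∧ IsItemPoint e n i a m ∧
      ∀ j < n, ∀ q, e j = .take q a → m < j := by
  obtain ⟨i, hd⟩ := hx.exists_during hl (by rw [he]; exact id)
  by_cases hc : ∃ c, c < n ∧ During e i c ∧ e c = .publish p ∧ ¬ TakenBefore e a c
  · obtain ⟨c, h1, h2, h3, h4⟩ := hc
    refine ⟨i, c, hd, ⟨p, l, hl, hd, he, .inl ⟨h1, h2, h3, h4⟩⟩, fun j _ q hj => ?_⟩
    rcases lt_trichotomy c j with h | rfl | h
    · exact h
    · simp [h3] at hj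
    · exact absurd ⟨j, h, q, hj⟩ h4
  · push Not at hc
    exact ⟨i, l, hd, ⟨p, l, hl, hd, he, .inr ⟨rfl, hc⟩⟩,
      fun j hj q ht => hx.insert_lt_take hl hj he ht⟩

theorem IsExec.point_of_push (hx : IsExec prio s e n) {i m k : ℕ} {p : Place} {t : Task}
    (hi : e i = .invPush p k t) (h : IsPoint e n i m) : IsPushPoint e n i m := by
  rcases h with h | ⟨h1, h2, ⟨q, a, h3⟩ | ⟨q, h3⟩⟩
  · exact h
  · have := hx.take_pop h1 h2 h3
    simp [hi] at this
  · have := hx.retPop_pop h1 h2 h3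
    simp [hi] at this

theorem IsExec.point_unique (hx : IsExec prio s e n) {i m m' : ℕ} (h : IsPoint e n i m)
    (h' : IsPoint e n i m') : m = m' := by
  have key : ∀ {m m' : ℕ}, IsPushPoint e n i m → IsPoint e n i m' → m = m' := by
    intro m m' h h'
    obtain ⟨a, ha⟩ := isPushPoint_iff.1 h
    obtain ⟨p, k, t, hi, -⟩ := hx.itemPoint_push ha
    obtain ⟨a', ha'⟩ := isPushPoint_iff.1 (hx.point_of_push hi h')
    obtain rfl := hx.itemPoint_item_unique ha ha'
    exact (hx.itemPoint_unique ha ha').2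
  by_cases hp : IsPushPoint e n i m
  · exact key hp h'
  by_cases hp' : IsPushPoint e n i m'
  · exact (key hp' h).symm
  obtain ⟨h1, h2, h3⟩ := h.resolve_left hp
  obtain ⟨h1', h2', h3'⟩ := h'.resolve_left hp'
  rcases h3 with ⟨q, a, h3⟩ | ⟨q, h3⟩ <;> rcases h3' with ⟨q', a', h3'⟩ | ⟨q', h3'⟩
  · exact hx.take_unique h1 h1' h2 h2' h3 h3'
  · exact absurd h3 (hx.not_take_of_ret h1' h2' h3' h2)
  · exact absurd h3' (hx.not_take_of_ret h1 h2 h3 h2')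
  · exact h2.ret_unique h2' (by simp [h3, Event.IsRet]) (by simp [h3', Event.IsRet])

/-- Every completed operation has a linearization point. -/
theorem IsExec.exists_point (hx : IsExec prio s e n) {i j : ℕ} (hj : j < n)
    (hd : During e i j) (hr : (e j).IsRet) : ∃ m, IsPoint e n i m := by
  have st := hx.2 j hj
  rcases hx.push_or_pop hj hd with ⟨p, k, t, hi, hp, h9⟩ | ⟨p, hi, hp, h9⟩
  · have hpe := hd.pending
    rcases hej : e j with _ | _ | _ | _ | _ | _ | q | ⟨q, r⟩
    case retPush =>
      rw [hej] at st hp hpe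
      change q = p at hp
      subst hp
      have hpc := st.of_retPush
      rcases hx.push_trace hi hpe hj.le with h | ⟨a, h, -⟩ | ⟨-, l, a, h1, h2, h3⟩
      · simp [hpc] at h
      · simp [hpc] at h
      · obtain ⟨i', m, hd', hm, -⟩ := hx.exists_itemPoint (h2.trans hj) h3
        have hdl : During e i l := (hpe.mono h1 h2.le).during (by rw [h3]; rfl)
        obtain rfl := hx.during_unique (h2.trans hj) hd' hdl
        exact ⟨m, .inl (isPushPoint_iff.2 ⟨a, hm⟩)⟩
    case retPop =>
      have := hx.retPop_pop hj hd hej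
      simp [hi] at this
    all_goals
      rw [hej] at hr
      exact hr.elim
  · rcases hej : e j with _ | _ | _ | _ | _ | _ | q | ⟨q, r⟩
    case retPush =>
      rw [hej] at st hp
      change q = p at hp
      subst hp
      simp [st.of_retPush, PC.stage] at h9
    case retPop =>
      rcases r with _ | t
      · exact ⟨j, .inr ⟨hj, hd, .inr ⟨q, hej⟩⟩⟩
      · obtain ⟨m, a, d, h1, h2, h3, -⟩ := hx.take_of_ret hj hd hej
        exact ⟨m, .inr ⟨h1, h2, .inl ⟨q, a, h3⟩⟩⟩
    all_goals
      rw [hej] at hr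
      exact hr.elim

/-! ### The abstract state -/

/-- The linearization point of a `push` makes its item available. -/
theorem IsExec.live_push (hx : IsExec prio s e n) {i a m : ℕ} (h : IsItemPoint e n i a m) :
    ¬ Live e n m a ∧ ∀ b, Live e n (m + 1) b ↔ b = a ∨ Live e n m b := by
  have htb : ∀ b, TakenBefore e b (m + 1) ↔ TakenBefore e b m := fun b => by
    rw [takenBefore_succ, or_iff_left]
    rintro ⟨q, hq⟩
    exact h.ne_take hq
  refine ⟨?_, fun b => ?_⟩
  · rintro ⟨⟨i', j, h', hj⟩, -⟩
    have := (hx.itemPoint_unique h h').2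
    omega
  · simp only [Live, htb]
    constructor
    · rintro ⟨⟨i', j, h', hj⟩, hb⟩
      rcases (Nat.lt_succ_iff.1 hj).lt_or_eq with hlt | rfl
      · exact .inr ⟨⟨i', j, h', hlt⟩, hb⟩
      · obtain rfl := hx.during_unique h.lt_and_during.1 h.lt_and_during.2 h'.lt_and_during.2
        exact .inl (hx.itemPoint_item_unique h' h)
    · rintro (rfl | ⟨⟨i', j, h', hj⟩, hb⟩)
      · exact ⟨⟨i, m, h, m.lt_succ_self⟩, hx.itemPoint_not_taken h⟩
      · exact ⟨⟨i', j, h', by omega⟩, hb⟩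

/-- Taking an item makes it unavailable, and it was available before. -/
theorem IsExec.live_take (hx : IsExec prio s e n) {a m : ℕ} {q : Place} (hm : m < n)
    (h : e m = .take q a) :
    ¬ Live e n (m + 1) a ∧ ∀ b, Live e n m b ↔ b = a ∨ Live e n (m + 1) b := by
  refine ⟨fun hl => hl.2 ⟨m, m.lt_succ_self, q, h⟩, fun b => ?_⟩
  constructor
  · rintro ⟨⟨i, j, hp, hj⟩, hb⟩
    by_cases hba : b = a
    · exact .inl hba
    · refine .inr ⟨⟨i, j, hp, by omega⟩, ?_⟩
      rw [takenBefore_succ, not_or]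
      refine ⟨hb, ?_⟩
      rintro ⟨q', hq'⟩
      rw [h] at hq'
      cases hq'
      exact hba rfl
  · rintro (rfl | ⟨⟨i, j, hp, hj⟩, hb⟩)
    · obtain ⟨G, L, hinv⟩ := hx.inv hm.le
      have st := hx.2 m hm
      rw [h] at st
      obtain ⟨ht, hs, -⟩ := hinv.of_take st
      obtain ⟨l, hl, p, he⟩ := (hx.stored_iff hm.le b).1 hs
      obtain ⟨i, j, -, hp, hlt⟩ := hx.exists_itemPoint (hl.trans hm) he
      refine ⟨⟨i, j, hp, hlt m hm q h⟩, fun htb => ?_⟩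
      rw [← hx.taken_iff hm.le, ht] at htb
      simp at htb
    · refine ⟨⟨i, j, hp, ?_⟩, fun htb => hb (takenBefore_succ.2 (.inl htb))⟩
      rcases (Nat.lt_succ_iff.1 hj).lt_or_eq with hlt | rfl
      · exact hlt
      · exact absurd h hp.ne_take

theorem IsExec.live_end (hx : IsExec prio s e n) (a : ℕ) :
    Live e n n a ↔ (s n).Stored a ∧ (s n).taken a = false := by
  rw [Live, ← hx.taken_iff le_rfl, Bool.not_eq_true, hx.stored_iff le_rfl]
  refine and_congr_left fun _ => ⟨?_, ?_⟩
  · rintro ⟨i, j, ⟨p, l, hl, -, he, -⟩, -⟩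
    exact ⟨l, hl, p, he⟩
  · rintro ⟨l, hl, p, he⟩
    obtain ⟨i, j, -, hp, -⟩ := hx.exists_itemPoint hl he
    exact ⟨i, j, hp, hp.lt_and_during.1⟩

theorem IsExec.liveItems_insert (hx : IsExec prio s e n) {m m' a : ℕ} {d : ItemData Place Task}
    (hd : (s n).item a = some d) (hl : ¬ Live e n m a)
    (h : ∀ b, Live e n m' b ↔ b = a ∨ Live e n m b) :
    tasksOf (s n).item (liveItems s e n m') =
      d.task ::ₘ tasksOf (s n).item (liveItems s e n m) := by
  obtain ⟨G, L, hinv⟩ := hx.inv le_rfl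
  have ha : a < (s n).fresh := by
    by_contra hlt
    rw [hinv.mem.fresh a (not_lt.1 hlt)] at hd
    simp at hd
  have : liveItems s e n m' = insert a (liveItems s e n m) := by
    ext b
    simp only [liveItems, Finset.mem_filter, Finset.mem_range, Finset.mem_insert, h]
    constructor
    · rintro ⟨h1, h2 | h2⟩
      · exact .inl h2
      · exact .inr ⟨h1, h2⟩
    · rintro (rfl | ⟨h1, h2⟩)
      · exact ⟨ha, .inl rfl⟩
      · exact ⟨h1, .inr h2⟩
  rw [this, tasksOf_insert (by simp [liveItems, hl]) hd]

open Classical in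
/-- The result of the operation invoked at step `i`: the task of the item that it takes. -/
noncomputable def resultOf (s : ℕ → Config Place Task) (e : ℕ → Event Place Task) (n i : ℕ) :
    Option Task :=
  if h : ∃ t m q a d, m < n ∧ During e i m ∧ e m = .take q a ∧ (s n).item a = some d ∧ d.task = t
  then some h.choose else none

theorem IsExec.resultOf_take (hx : IsExec prio s e n) {i m a : ℕ} {q : Place}
    {d : ItemData Place Task} (hm : m < n) (hd : During e i m) (he : e m = .take q a)
    (ha : (s n).item a = some d) : resultOf s e n i = some d.task := by
  have hex : ∃ t m q a d, m < n ∧ During e i m ∧ e m = .take q a ∧ (s n).item a = some d ∧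
      d.task = t := ⟨_, m, q, a, d, hm, hd, he, ha, rfl⟩
  rw [resultOf, dif_pos hex]
  obtain ⟨m', q', a', d', hm', hd', he', ha', ht⟩ := hex.choose_spec
  obtain rfl := hx.take_unique hm hm' hd hd' he he'
  cases he.symm.trans he'
  rw [← ht, Option.some.inj (ha.symm.trans ha')]

theorem IsExec.resultOf_ret (hx : IsExec prio s e n) {i j : ℕ} {q : Place} {r : Option Task}
    (hj : j < n) (hd : During e i j) (he : e j = .retPop q r) : resultOf s e n i = r := by
  rcases r with _ | t
  · refine dif_neg ?_
    rintro ⟨t, m, q', a, d, hm, hdm, hem, -⟩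
    exact hx.not_take_of_ret hj hd he hdm hem
  · obtain ⟨m, a, d, hm, hdm, hem, ha, rfl⟩ := hx.take_of_ret hj hd he
    exact hx.resultOf_take hm hdm hem ha

theorem pushLinearizable (prio : Task → Prio) : PushLinearizable Place prio := by
  classical
  intro s e n hx
  let pt : ℕ → Option ℕ := fun i => if h : ∃ m, IsPoint e n i m then some h.choose else none
  have hpt : ∀ i m, pt i = some m ↔ IsPoint e n i m := by
    intro i m
    by_cases h : ∃ m, IsPoint e n i m
    · simp only [pt, dif_pos h, Option.some.injEq]
      exact ⟨fun hm => hm ▸ h.choose_spec, fun hm => hx.point_unique h.choose_spec hm⟩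
    · simp only [pt, dif_neg h, reduceCtorEq, false_iff]
      exact fun hm => h ⟨m, hm⟩
  have hitem : ∀ {m a : ℕ} {q : Place}, m < n → e m = .take q a →
      ∃ d, (s n).item a = some d := by
    intro m a q hm he
    obtain ⟨G, L, hinv⟩ := hx.inv hm.le
    have st := hx.2 m hm
    rw [he] at st
    obtain ⟨-, -, d, hd, -⟩ := hinv.of_take st
    exact ⟨d, hx.item_mono hm.le le_rfl hd⟩
  refine ⟨pt, resultOf s e n, fun m => tasksOf (s n).item (liveItems s e n m),
    ⟨fun i m h => ((hpt i m).1 h).lt_and_during, fun i j m h h' => ?_, fun i j hj hd hr => ?_,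
      fun i j p r hj hd he => hx.resultOf_ret hj hd he, ?_, fun i m h => ?_,
      fun m hm h => ?_⟩, fun i hi p k t he m => ?_, fun i m t p hi h hr => ?_, ?_⟩
  · have h1 := ((hpt i m).1 h).lt_and_during
    exact hx.during_unique h1.1 h1.2 ((hpt j m).1 h').lt_and_during.2
  · obtain ⟨m, hm⟩ := hx.exists_point hj hd hr
    exact ⟨m, (hpt i m).2 hm⟩
  · have : liveItems s e n 0 = ∅ := by
      ext b
      simp [liveItems, Live]
    simp [this, tasksOf]
  · rcases (hpt i m).1 h with h | ⟨hm, hd, ⟨q, a, he⟩ | ⟨q, he⟩⟩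
    · obtain ⟨a, ha⟩ := isPushPoint_iff.1 h
      obtain ⟨p, k, t, hi, hd⟩ := hx.itemPoint_push ha
      obtain ⟨h1, h2⟩ := hx.live_push ha
      rw [hi]
      exact hx.liveItems_insert hd h1 h2
    · obtain ⟨d, ha⟩ := hitem hm he
      obtain ⟨h1, h2⟩ := hx.live_take hm he
      rw [hx.take_pop hm hd he, hx.resultOf_take hm hd he ha]
      exact hx.liveItems_insert ha h1 h2
    · rw [hx.retPop_pop hm hd he, hx.resultOf_ret hm hd he]
      refine congrArg _ (liveItems_congr (live_frame (fun i' a hp => hp.ne_retPop he) ?_))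
      simp [he]
  · refine congrArg _ (liveItems_congr (live_frame (fun i a hp => ?_) fun q a he => ?_))
    · exact h i ((hpt i m).2 (.inl (isPushPoint_iff.2 ⟨a, hp⟩)))
    · obtain ⟨i, hd⟩ := hx.exists_during hm (by rw [he]; exact id)
      exact h i ((hpt i m).2 (.inr ⟨hm, hd, .inl ⟨q, a, he⟩⟩))
  · rw [hpt]
    exact ⟨hx.point_of_push he, .inl⟩
  · rcases (hpt i m).1 h with h | ⟨hm, hd, ⟨q, a, he⟩ | ⟨q, he⟩⟩
    · obtain ⟨a, ha⟩ := isPushPoint_iff.1 h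
      obtain ⟨p, k, t, hi', -⟩ := hx.itemPoint_push ha
      simp [hi] at hi'
    · have := hx.take_pop hm hd he
      rw [hi] at this
      cases this
      exact ⟨a, he⟩
    · rw [hx.resultOf_ret hm hd he] at hr
      simp at hr
  · have : (liveItems s e n n).val = (Multiset.range (s n).fresh).filter
        fun a => (s n).Stored a ∧ (s n).taken a = false := by
      rw [liveItems, Finset.filter_val, Finset.range_val]
      exact Multiset.filter_congr fun a _ => hx.live_end a
    simp only [tasksOf, this, Config.contents]

end Linearization

end HybridK

theorem theorem3 {Place Task Prio : Type*} [Fintype Place] [DecidableEq Place]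
    [LinearOrder Prio] (prio : Task → Prio) :
    HybridK.PushLockFree Place prio ∧
    HybridK.PushWaitFreeWithRoom Place prio ∧
    HybridK.PushLinearizable Place prio ∧
    HybridK.LocalListsRelaxed Place prio :=
  ⟨HybridK.pushLockFree prio, HybridK.pushWaitFreeWithRoom prio, HybridK.pushLinearizable prio,
    HybridK.localListsRelaxed prio⟩
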